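/- Let $M$ be a smooth ($C^\infty$) manifold without boundary of dimension $m$ and $Z$ a smooth vector field on $M$. Trajectories are the images of maximal integral curves of $Z$. A trajectory is regular if it is not a single zero of $Z$. The $\omega$-limit (resp. $\alpha$-limit) of a trajectory is the set of limit points of a maximal integral curve parametrizing it as the parameter tends to the right (resp. left) end of its interval of definition. A singularity is a zero of $Z$; it is isolated if some neighbourhood contains no other zero. - A *pseudo-circle* of $Z$ is a subspace of $M$ homeomorphic to $S^1$ that consists of a regular trajectory and an isolated singularity. - A point $p$ is a *source* of $Z$ if an open neighbourhood of $p$ is diffeomorphic to an open ball $B(r)\subset\mathbb R^m$ centred at the origin, with $p$ corresponding to $0$, so that in these coordinates $Z=\varphi\cdot\sum_{j=1}^m x_j\,\partial/\partial x_j$, where $\varphi$ is a smooth non-negative function on $B(r)$, $\varphi^{-1}(0)$ is countable, and $\varphi$ has at most finitely many zeros on each ray issuing from the origin. - A point $q$ is a *rivet* of $Z$ if it is an isolated singularity, if $Z=\psi\tilde Z$ near $q$ for a smooth function $\psi$ and a smooth vector field $\tilde Z$ with $\tilde Z(q)\neq0$, and if no regular trajectory has $\{q\}$ both as $\alpha$-limit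 and as $\omega$-limit. - A *chain* of $Z$ is a finite sequence of three or more pairwise different regular trajectories such that the $\alpha$-limit of the first one is empty or consists of a source, the $\omega$-limit of the last one is a pseudo-circle, and for any two consecutive ones the $\omega$-limit of the former equals the $\alpha$-limit of the latter and consists of a single rivet. - A set $Q\subset M$ *can be enclosed in dimension $\ell$* if it is contained in a countable union of submanifolds of $M$ of dimension at most $\ell$. The vector field $Z$ is called *limit* if: 1. the set of zeros of $Z$ has no accumulation point in $M$; 2. $Z$ has exactly one pseudo-circle; 3. there is a set $Q\subset M$ that can be enclosed in dimension $m-1$ such that the trajectory of every point of $M\setminus Q$ has the pseudo-circle as $\omega$-limit; 4. $Z$ has no chain and no periodic regular trajectory. **Proposition.** For every $k\ge2$, the sphere $S^k$, with its standard smooth structure, supports a limit vector field. -/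

import Mathlib

open Set Filter Topology
open scoped Manifold ContDiff

namespace LimitField

/-- Vector fields (not necessarily smooth) on an `m`-dimensional manifold `M`. -/
abbrev VectorField (m : ℕ) (M : Type*) [TopologicalSpace M]
    [ChartedSpace (EuclideanSpace ℝ (Fin m)) M] : Type _ :=
  (x : M) → TangentSpace (𝓡 m) x

section

variable {m : ℕ} {M : Type*} [TopologicalSpace M] [ChartedSpace (EuclideanSpace ℝ (Fin m)) M]
  [IsManifold (𝓡 m) ∞ M]

/-- `Z` is a smooth (`C^∞`) vector field on the subset `U` of `M`. -/
def SmoothFieldOn (Z : VectorField m M) (U : Set M) : Prop :=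
  ContMDiffOn (𝓡 m) (𝓡 m).tangent ∞ (fun x => (⟨x, Z x⟩ : TangentBundle (𝓡 m) M)) U

/-- `γ`, on the nonempty open interval `J`, is a maximal integral curve of `Z`. The values of `γ`
outside `J` are irrelevant. -/
structure IsMaximalIntegralCurve (Z : VectorField m M) (γ : ℝ → M) (J : Set ℝ) : Prop where
  isOpen : IsOpen J
  ordConnected : J.OrdConnected
  nonempty : J.Nonempty
  integralCurve : IsMIntegralCurveOn γ Z J
  maximal : ∀ (γ' : ℝ → M) (J' : Set ℝ), IsOpen J' → J'.OrdConnected → J ⊆ J' →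
    IsMIntegralCurveOn γ' Z J' → EqOn γ γ' J → J' ⊆ J

/-- The trajectory (orbit) of the point `p`. -/
def trajectory (Z : VectorField m M) (p : M) : Set M :=
  {q | ∃ (γ : ℝ → M) (J : Set ℝ), IsMaximalIntegralCurve Z γ J ∧ p ∈ γ '' J ∧ q ∈ γ '' J}

/-- The `ω`-limit of the trajectory of `p`: the set of limits of `γ (t i)` for `t i` tending to
the right end of the interval of definition of the maximal integral curve `γ` through `p`. -/
def omegaLim (Z : VectorField m M) (p : M) : Set M :=
  {q | ∃ (γ : ℝ → M) (J : Set ℝ), IsMaximalIntegralCurve Z γ J ∧ p ∈ γ '' J ∧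
    ∀ t ∈ J, q ∈ closure (γ '' (J ∩ Ici t))}

/-- The `α`-limit of the trajectory of `p`. -/
def alphaLim (Z : VectorField m M) (p : M) : Set M :=
  {q | ∃ (γ : ℝ → M) (J : Set ℝ), IsMaximalIntegralCurve Z γ J ∧ p ∈ γ '' J ∧
    ∀ t ∈ J, q ∈ closure (γ '' (J ∩ Iic t))}

/-- The trajectory of `p` is regular (that is, not a single zero of `Z`) and periodic. -/
def IsPeriodicRegular (Z : VectorField m M) (p : M) : Prop :=
  Z p ≠ 0 ∧ ∃ γ : ℝ → M, IsMIntegralCurve γ Z ∧ p ∈ range γ ∧ ∃ T : ℝ, 0 < T ∧ γ.Periodic T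

/-- `q` is an isolated singularity (zero) of `Z`. -/
def IsIsolatedSingularity (Z : VectorField m M) (q : M) : Prop :=
  Z q = 0 ∧ ∀ᶠ x in 𝓝[≠] q, Z x ≠ 0

/-- `P` is a pseudo-circle of `Z`: it is homeomorphic to the circle and consists of a regular
trajectory and an isolated singularity. -/
def IsPseudoCircle (Z : VectorField m M) (P : Set M) : Prop :=
  Nonempty (P ≃ₜ Circle) ∧
    ∃ p q : M, Z p ≠ 0 ∧ IsIsolatedSingularity Z q ∧ P = trajectory Z p ∪ {q}

/-- `p` is a source of `Z`: in a smooth chart `e` of a neighbourhood of `p` onto an open ball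
centred at `e p = 0`, one has `Z = φ · ∑ x_j ∂/∂x_j`, where `φ` is smooth and non-negative, has
countably many zeros, and has finitely many zeros on each ray issuing from the origin. -/
def IsSource (Z : VectorField m M) (p : M) : Prop :=
  ∃ e ∈ IsManifold.maximalAtlas (𝓡 m) ∞ M, ∃ r : ℝ, 0 < r ∧ p ∈ e.source ∧ e p = 0 ∧
    e.target = Metric.ball 0 r ∧
    ∃ φ : EuclideanSpace ℝ (Fin m) → ℝ, ContDiffOn ℝ ∞ φ (Metric.ball 0 r) ∧
      (∀ x ∈ Metric.ball 0 r, 0 ≤ φ x) ∧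
      {x ∈ Metric.ball 0 r | φ x = 0}.Countable ∧
      (∀ v : EuclideanSpace ℝ (Fin m), v ≠ 0 →
        {t : ℝ | 0 < t ∧ t • v ∈ Metric.ball 0 r ∧ φ (t • v) = 0}.Finite) ∧
      ∀ x ∈ e.source, mfderiv (𝓡 m) (𝓡 m) e x (Z x) = φ (e x) • e x

/-- `q` is a rivet of `Z`. -/
def IsRivet (Z : VectorField m M) (q : M) : Prop :=
  IsIsolatedSingularity Z q ∧
  (∃ U : Set M, IsOpen U ∧ q ∈ U ∧ ∃ (ψ : M → ℝ) (Z' : VectorField m M),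
    ContMDiffOn (𝓡 m) 𝓘(ℝ, ℝ) ∞ ψ U ∧ SmoothFieldOn Z' U ∧ Z' q ≠ 0 ∧
      ∀ x ∈ U, Z x = ψ x • Z' x) ∧
  ¬ ∃ p : M, Z p ≠ 0 ∧ alphaLim Z p = {q} ∧ omegaLim Z p = {q}

/-- The regular trajectories of `c 0, …, c (n + 2)` are, in this order, the links of a chain of
`Z` (of order `n + 3`). -/
structure IsChain (Z : VectorField m M) (n : ℕ) (c : Fin (n + 3) → M) : Prop where
  regular : ∀ i, Z (c i) ≠ 0
  different : Function.Injective fun i => trajectory Z (c i)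
  first : (∃ p, IsSource Z p ∧ alphaLim Z (c 0) = {p}) ∨ alphaLim Z (c 0) = ∅
  last : IsPseudoCircle Z (omegaLim Z (c (Fin.last (n + 2))))
  consecutive : ∀ i : Fin (n + 2), omegaLim Z (c i.castSucc) = alphaLim Z (c i.succ) ∧
    ∃ q, IsRivet Z q ∧ omegaLim Z (c i.castSucc) = {q}

variable (m) in
/-- `N` is a (regular, not necessarily closed) smooth submanifold of dimension `d` of the
`m`-manifold `M`: near each of its points it is a slice in some smooth chart of `M`. -/
def IsSubmanifold (d : ℕ) (N : Set M) : Prop :=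
  ∀ x ∈ N, ∃ e ∈ IsManifold.maximalAtlas (𝓡 m) ∞ M, x ∈ e.source ∧
    ∃ L : Submodule ℝ (EuclideanSpace ℝ (Fin m)), Module.finrank ℝ L = d ∧
      ∀ y ∈ e.source, y ∈ N ↔ e y ∈ L

variable (m) in
/-- `Q` can be enclosed in dimension `l`: it is covered by countably many submanifolds of
dimension at most `l`. -/
def EnclosedInDim (l : ℕ) (Q : Set M) : Prop :=
  ∃ F : Set (Set M), F.Countable ∧ (∀ N ∈ F, ∃ d ≤ l, IsSubmanifold m d N) ∧ Q ⊆ ⋃₀ F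

/-- `Z` is a limit vector field: a smooth vector field with discrete zero set, exactly one
pseudo-circle, a set `Q` enclosed in codimension one outside of which every point has this
pseudo-circle as `ω`-limit, no chain, and no periodic regular trajectory. -/
structure IsLimit (Z : VectorField m M) : Prop where
  smooth : SmoothFieldOn Z univ
  zeros_discrete : ∀ x : M, ¬ AccPt x (𝓟 {y | Z y = 0})
  unique_pseudoCircle : ∃! P : Set M, IsPseudoCircle Z P
  exists_enclosed : ∃ Q : Set M, EnclosedInDim m (m - 1) Q ∧
    ∀ p ∉ Q, IsPseudoCircle Z (omegaLim Z p)
  no_chain : ¬ ∃ (n : ℕ) (c : Fin (n + 3) → M), IsChain Z n c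
  no_periodic : ¬ ∃ p : M, IsPeriodicRegular Z p

end

end LimitField

/-!
Write `k = n + 2` and let the linear flow on `ℝ^(n+3)` rotate the plane of the first two
coordinates with unit speed and contract the remaining coordinates with exponents `1, 2, …, n + 1`.
Acting on rays, it induces a smooth flow on the sphere (`sphereFlow`). Its generator is multiplied
by `1 - x₀`, which is positive except at the point `basePt n = (1, 0, …, 0)`, where it vanishes. The
result, `slowedField n`, is a limit vector field.

The great circle `loop n` in the plane of rotation is the union of the zero `basePt n` and one
regular trajectory with both limits there, parametrized by `t ↦ π + 2 arctan t`. Off the loop the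
factor `1 - x₀` only changes the time of trajectories (`exists_time_change`). A point off the loop
with a nonzero component in the plane of rotation spirals towards the whole loop
(`omegaLim_of_notMem_loop`), and the other points, together with the loop, lie in two great
hyperspheres. The remaining zeros are the unit vectors `± e_j` on the contracted axes
(`slowedField_eq_zero_iff`).

A regular point off the loop has nonzero coordinates of two different exponents, so along its
trajectory the squared norm of the least contracted block is strictly monotone
(`exists_strictMono_sphereFlow`). This excludes periodic trajectories, and also further
pseudo-circles, since a trajectory together with one point is then not compact
(`not_isCompact_range_union`).

There is no chain because no regular trajectory has a single rivet as `ω`-limit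
(`not_isRivet_of_omegaLim`). The base point is not a rivet, the loop being homoclinic to it. If the
limit is `± e_j`, the trajectory lies in the sphere of the contracted coordinates, so there is a
second contracted axis; then the field near `± e_j` takes directions which no continuous
nonvanishing field can be proportional to (`factor_eq_zero`).
-/

namespace LimitField

/-! ### Maximal integral curves and limit sets -/

section IntegralCurves

variable {m : ℕ} {M : Type*} [TopologicalSpace M] [ChartedSpace (EuclideanSpace ℝ (Fin m)) M]
  {Z : VectorField m M} {γ γ' : ℝ → M} {J : Set ℝ} {p : M}

theorem isMaximalIntegralCurve_univ (hγ : IsMIntegralCurve γ Z) :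
    IsMaximalIntegralCurve Z γ univ where
  isOpen := isOpen_univ
  ordConnected := ordConnected_univ
  nonempty := univ_nonempty
  integralCurve := hγ.isMIntegralCurveOn _
  maximal _ _ _ _ _ _ _ := subset_univ _

variable [IsManifold (𝓡 m) ∞ M]

theorem SmoothFieldOn.contMDiff (hZ : SmoothFieldOn Z univ) :
    ContMDiff (𝓡 m) (𝓡 m).tangent ∞ (fun x => (⟨x, Z x⟩ : TangentBundle (𝓡 m) M)) :=
  contMDiffOn_univ.1 hZ

/-- Uniqueness of integral curves on an open order-connected set. -/
theorem eqOn_of_isMIntegralCurve [T2Space M] (hZ : SmoothFieldOn Z univ)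
    (hγ : IsMIntegralCurve γ Z) (hJ : IsOpen J) (hJc : J.OrdConnected)
    (hγ' : IsMIntegralCurveOn γ' Z J) {t₀ : ℝ} (ht₀ : t₀ ∈ J) (h : γ' t₀ = γ t₀) :
    EqOn γ' γ J := by
  have : IsManifold (𝓡 m) 1 M := IsManifold.of_le (n := ∞) (by norm_cast)
  intro t ht
  have h₁ : min t t₀ ∈ J := by rcases min_choice t t₀ with h | h <;> rwa [h]
  have h₂ : max t t₀ ∈ J := by rcases max_choice t t₀ with h | h <;> rwa [h]
  obtain ⟨a, ha, haJ⟩ := Filter.nonempty_of_mem (Filter.inter_mem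
    (nhdsWithin_le_nhds (hJ.mem_nhds h₁)) (self_mem_nhdsWithin (s := Iio (min t t₀))))
  obtain ⟨b, hb, hbJ⟩ := Filter.nonempty_of_mem (Filter.inter_mem
    (nhdsWithin_le_nhds (hJ.mem_nhds h₂)) (self_mem_nhdsWithin (s := Ioi (max t t₀))))
  have hsub : Ioo a b ⊆ J := Ioo_subset_Icc_self.trans (hJc.out ha hb)
  simp only [mem_Iio, lt_min_iff, mem_Ioi, max_lt_iff] at haJ hbJ
  exact isMIntegralCurveOn_Ioo_eqOn_of_contMDiff_boundaryless (I := 𝓡 m) (t₀ := t₀)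
    ⟨haJ.2, hbJ.2⟩ (hZ.contMDiff.of_le (by norm_cast)) (hγ'.mono hsub)
    (hγ.isMIntegralCurveOn _) h ⟨haJ.1, hbJ.1⟩

/-- If a global integral curve `γ` passes through `p`, then every maximal integral curve through
`p` is a translate of `γ`. -/
theorem IsMaximalIntegralCurve.eq_translate [T2Space M] (hZ : SmoothFieldOn Z univ)
    (hγ : IsMIntegralCurve γ Z) (hp : p ∈ range γ) (h : IsMaximalIntegralCurve Z γ' J)
    (hp' : p ∈ γ' '' J) : J = univ ∧ ∃ c, γ' = fun t => γ (t + c) := by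
  obtain ⟨t₀, rfl⟩ := hp
  obtain ⟨t₁, ht₁, ht⟩ := hp'
  have hg : IsMIntegralCurve (fun t => γ (t + (t₀ - t₁))) Z := hγ.comp_add _
  have heq := eqOn_of_isMIntegralCurve hZ hg h.isOpen h.ordConnected h.integralCurve ht₁
    (by simpa using ht)
  have hJ : J = univ := eq_univ_of_univ_subset
    (h.maximal _ univ isOpen_univ ordConnected_univ (subset_univ _) (hg.isMIntegralCurveOn _) heq)
  subst hJ
  exact ⟨rfl, t₀ - t₁, funext fun t => heq (mem_univ t)⟩

variable [T2Space M]

theorem trajectory_eq_range (hZ : SmoothFieldOn Z univ) (hγ : IsMIntegralCurve γ Z)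
    (hp : p ∈ range γ) : trajectory Z p = range γ := by
  ext q
  constructor
  · rintro ⟨γ', J, h, hp', t, -, rfl⟩
    obtain ⟨-, c, rfl⟩ := h.eq_translate hZ hγ hp hp'
    exact ⟨t + c, rfl⟩
  · intro hq
    exact ⟨γ, univ, isMaximalIntegralCurve_univ hγ, by rwa [image_univ], by rwa [image_univ]⟩

theorem mem_omegaLim_iff (hZ : SmoothFieldOn Z univ) (hγ : IsMIntegralCurve γ Z)
    (hp : p ∈ range γ) {q : M} :
    q ∈ omegaLim Z p ↔ MapClusterPt q atTop γ := by
  rw [mapClusterPt_atTop_iff_forall_mem_closure]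
  constructor
  · rintro ⟨γ', J, h, hp', hq⟩ t
    obtain ⟨rfl, c, rfl⟩ := h.eq_translate hZ hγ hp hp'
    refine closure_mono ?_ (hq (t - c) (mem_univ _))
    rintro _ ⟨s, ⟨-, hs⟩, rfl⟩
    exact ⟨s + c, by simp only [mem_Ici] at hs ⊢; linarith, rfl⟩
  · intro hq
    exact ⟨γ, univ, isMaximalIntegralCurve_univ hγ, by rwa [image_univ], fun t _ => by
      simpa using hq t⟩

theorem mem_alphaLim_iff (hZ : SmoothFieldOn Z univ) (hγ : IsMIntegralCurve γ Z)
    (hp : p ∈ range γ) {q : M} :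
    q ∈ alphaLim Z p ↔ MapClusterPt q atBot γ := by
  simp only [MapClusterPt, (atBot_basis.map γ).clusterPt_iff_forall_mem_closure, forall_true_left]
  constructor
  · rintro ⟨γ', J, h, hp', hq⟩ t
    obtain ⟨rfl, c, rfl⟩ := h.eq_translate hZ hγ hp hp'
    refine closure_mono ?_ (hq (t - c) (mem_univ _))
    rintro _ ⟨s, ⟨-, hs⟩, rfl⟩
    exact ⟨s + c, by simp only [mem_Iic] at hs ⊢; linarith, rfl⟩
  · intro hq
    exact ⟨γ, univ, isMaximalIntegralCurve_univ hγ, by rwa [image_univ], fun t _ => by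
      simpa using hq t⟩

end IntegralCurves

/-! ### Generators of smooth flows and time changes -/

section Generator

variable {m : ℕ} {M : Type*} [TopologicalSpace M] [ChartedSpace (EuclideanSpace ℝ (Fin m)) M]

/-- The velocity field of a family of curves `t ↦ Φ t x` with `Φ 0 x = x`. The velocity at time `0`
is a tangent vector at `Φ 0 x`; both tangent spaces are the model space, and are identified through
it. -/
noncomputable def generator (Φ : ℝ → M → M) : VectorField m M :=
  fun x => (mfderiv 𝓘(ℝ, ℝ) (𝓡 m) (fun t => Φ t x) 0 (1 : ℝ) : EuclideanSpace ℝ (Fin m))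

/-- A smooth global flow on `M`. -/
structure IsSmoothFlow (Φ : ℝ → M → M) : Prop where
  zero : ∀ x, Φ 0 x = x
  add : ∀ s t x, Φ (s + t) x = Φ s (Φ t x)
  smooth : ContMDiff (𝓘(ℝ, ℝ).prod (𝓡 m)) (𝓡 m) ∞ fun y : ℝ × M => Φ y.1 y.2

variable {Φ : ℝ → M → M}

theorem IsSmoothFlow.contMDiff_curve (h : IsSmoothFlow (m := m) Φ) (x : M) :
    ContMDiff 𝓘(ℝ, ℝ) (𝓡 m) ∞ fun t => Φ t x :=
  h.smooth.comp (contMDiff_id.prodMk contMDiff_const)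

theorem IsSmoothFlow.isMIntegralCurve (h : IsSmoothFlow (m := m) Φ) (x : M) :
    IsMIntegralCurve (fun t => Φ t x) (generator (m := m) Φ) := by
  intro s
  have h₁ : HasMFDerivAt 𝓘(ℝ, ℝ) (𝓡 m) (fun t => Φ t (Φ s x)) (s - s)
      (mfderiv 𝓘(ℝ, ℝ) (𝓡 m) (fun t => Φ t (Φ s x)) (s - s)) :=
    ((h.contMDiff_curve _).mdifferentiable (by simp) _).hasMFDerivAt
  have h₂ : HasMFDerivAt 𝓘(ℝ, ℝ) 𝓘(ℝ, ℝ) (fun t : ℝ => t - s) s (ContinuousLinearMap.id ℝ ℝ) :=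
    ((hasFDerivAt_id s).sub_const s).hasMFDerivAt
  have h₃ := HasMFDerivAt.comp (f := fun t : ℝ => t - s) (g := fun t => Φ t (Φ s x)) s h₁ h₂
  have heq : ((fun t => Φ t (Φ s x)) ∘ fun t => t - s) = fun t => Φ t x := by
    ext t
    simp only [Function.comp_apply, ← h.add, sub_add_cancel]
  rw [heq] at h₃
  have key : ∀ u : ℝ, u = 0 → generator (m := m) Φ (Φ s x) =
      (mfderiv 𝓘(ℝ, ℝ) (𝓡 m) (fun t => Φ t (Φ s x)) u (1 : ℝ) : EuclideanSpace ℝ (Fin m)) := by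
    rintro u rfl
    rfl
  refine h₃.congr_mfderiv ?_
  ext
  exact (key _ (sub_self s)).symm.trans (one_smul ℝ _).symm

variable [IsManifold (𝓡 m) ∞ M]

theorem IsSmoothFlow.smoothFieldOn_generator (h : IsSmoothFlow (m := m) Φ) :
    SmoothFieldOn (generator (m := m) Φ) univ := by
  have : IsManifold (𝓡 m) 1 M := IsManifold.of_le (n := ∞) (by norm_cast)
  have h₁ : ContMDiff (𝓡 m) ((𝓘(ℝ, ℝ).prod (𝓡 m)).tangent) ∞ (fun x : M =>
      (equivTangentBundleProd 𝓘(ℝ, ℝ) ℝ (𝓡 m) M).symm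
        ((⟨0, (1 : ℝ)⟩ : TangentBundle 𝓘(ℝ, ℝ) ℝ), (⟨x, 0⟩ : TangentBundle (𝓡 m) M))) :=
    contMDiff_equivTangentBundleProd_symm.comp
      (contMDiff_const.prodMk (Bundle.contMDiff_zeroSection ℝ (TangentSpace (𝓡 m))))
  have h₂ := (h.smooth.contMDiff_tangentMap (m := ∞) (by norm_cast)).comp h₁
  refine contMDiffOn_univ.2 ?_
  convert! h₂ using 1
  ext1 x
  have key : ∀ (y : M) (v : EuclideanSpace ℝ (Fin m)), y = x →
      (⟨x, v⟩ : TangentBundle (𝓡 m) M) = ⟨y, v⟩ := by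
    rintro y v rfl
    rfl
  refine (key (Φ 0 x) _ (h.zero x)).trans ?_
  have hc : HasMFDerivAt 𝓘(ℝ, ℝ) (𝓘(ℝ, ℝ).prod (𝓡 m)) (fun t : ℝ => (t, x)) 0
      ((ContinuousLinearMap.id ℝ ℝ).prod 0) :=
    (hasMFDerivAt_id (I := 𝓘(ℝ, ℝ)) (0 : ℝ)).prodMk (hasMFDerivAt_const x 0)
  have hΦ : HasMFDerivAt (𝓘(ℝ, ℝ).prod (𝓡 m)) (𝓡 m) (fun y : ℝ × M => Φ y.1 y.2) (0, x)
      (mfderiv (𝓘(ℝ, ℝ).prod (𝓡 m)) (𝓡 m) (fun y : ℝ × M => Φ y.1 y.2) (0, x)) :=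
    (h.smooth.mdifferentiable (by simp) _).hasMFDerivAt
  have := (HasMFDerivAt.comp (f := fun t : ℝ => (t, x)) (0 : ℝ) hΦ hc).mfderiv
  refine congrArg (fun v : EuclideanSpace ℝ (Fin m) => (⟨Φ 0 x, v⟩ : TangentBundle (𝓡 m) M)) ?_
  exact congrArg (fun A : ℝ →L[ℝ] EuclideanSpace ℝ (Fin m) => A 1) this

end Generator

/-- Time change: if `σ' = f (γ ∘ σ)` then `γ ∘ σ` is an integral curve of `f • Z`. -/
theorem isMIntegralCurve_comp {m : ℕ} {M : Type*} [TopologicalSpace M]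
    [ChartedSpace (EuclideanSpace ℝ (Fin m)) M] {Z : VectorField m M} {γ : ℝ → M} {f : M → ℝ}
    {σ : ℝ → ℝ}
    (hγ : IsMIntegralCurve γ Z) (hσ : ∀ t, HasDerivAt σ (f (γ (σ t))) t) :
    IsMIntegralCurve (γ ∘ σ) (fun x => f x • Z x) := by
  intro t
  have h := (hγ (σ t)).comp t (hσ t).hasFDerivAt.hasMFDerivAt
  refine h.congr_mfderiv ?_
  ext
  change ((ContinuousLinearMap.toSpanSingleton ℝ (f (γ (σ t)))) (1 : ℝ)) • Z (γ (σ t)) =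
    (1 : ℝ) • (f (γ (σ t)) • Z (γ (σ t)))
  rw [ContinuousLinearMap.toSpanSingleton_apply, one_smul, one_smul]

/-- The equation `σ' = g ∘ σ` with `g` positive and bounded has a solution which is an increasing
bijection of `ℝ`: the inverse of a primitive of `1 / g`. -/
theorem exists_time_change {g : ℝ → ℝ} (hg : Continuous g) (hpos : ∀ s, 0 < g s) {C : ℝ}
    (hC : ∀ s, g s ≤ C) :
    ∃ σ : ℝ ≃o ℝ, ∀ t, HasDerivAt σ (g (σ t)) t := by
  have hC0 : 0 < C := (hpos 0).trans_le (hC 0)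
  have hcont : Continuous fun s => (g s)⁻¹ := hg.inv₀ fun s => (hpos s).ne'
  let G : ℝ → ℝ := fun s => ∫ u in (0 : ℝ)..s, (g u)⁻¹
  have hG : ∀ s, HasDerivAt G (g s)⁻¹ s := fun s => hcont.integral_hasStrictDerivAt 0 s |>.hasDerivAt
  have hmono : StrictMono G := strictMono_of_hasDerivAt_pos hG fun s => inv_pos.2 (hpos s)
  have hmono' : Monotone fun s => G s - C⁻¹ * s := by
    refine monotone_of_hasDerivAt_nonneg (f' := fun s => (g s)⁻¹ - C⁻¹ * 1)
      (fun s => (hG s).sub ((hasDerivAt_id s).const_mul _)) fun s => ?_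
    have := inv_anti₀ (hpos s) (hC s)
    simpa using this
  have hG0 : G 0 = 0 := intervalIntegral.integral_same
  have htop : Tendsto G atTop atTop := by
    refine tendsto_atTop_mono' _ ?_ (tendsto_id.const_mul_atTop (inv_pos.2 hC0))
    filter_upwards [eventually_ge_atTop 0] with s hs
    have := hmono' hs
    simp only [hG0, mul_zero, sub_zero, id] at this ⊢
    linarith
  have hbot : Tendsto G atBot atBot := by
    refine tendsto_atBot_mono' _ ?_ (tendsto_id.const_mul_atBot (inv_pos.2 hC0))
    filter_upwards [eventually_le_atBot 0] with s hs
    have := hmono' hs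
    simp only [hG0, mul_zero, sub_zero, id] at this ⊢
    linarith
  have hGc : Continuous G := continuous_iff_continuousAt.2 fun s => (hG s).continuousAt
  let e : ℝ ≃o ℝ := hmono.orderIsoOfSurjective G (hGc.surjective htop hbot)
  refine ⟨e.symm, fun t => ?_⟩
  have := HasDerivAt.of_local_left_inverse (f := G) (g := e.symm) (a := t)
    (e.symm.continuous.continuousAt) (hG (e.symm t)) (inv_pos.2 (hpos _)).ne'
    (Eventually.of_forall fun y => e.apply_symm_apply y)
  simpa using this

/-! ### Great hyperspheres -/

section Sphere

open Metric

variable {k : ℕ}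

/-- Great hyperspheres are submanifolds: the stereographic projection from the antipode of one of
their points takes them to hyperplanes. -/
theorem isSubmanifold_great_hypersphere {u : EuclideanSpace ℝ (Fin (k + 1))} (hu : u ≠ 0) :
    IsSubmanifold k (k - 1)
      {x : sphere (0 : EuclideanSpace ℝ (Fin (k + 1))) 1 | inner ℝ u (x : EuclideanSpace ℝ _) = 0} := by
  have := Fact.mk (@finrank_euclideanSpace_fin ℝ _ (k + 1))
  intro x hx
  refine ⟨chartAt (EuclideanSpace ℝ (Fin k)) x, IsManifold.chart_mem_maximalAtlas x,
    mem_chart_source _ x, ?_⟩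
  let U : (Submodule.span ℝ {((-x : sphere (0 : EuclideanSpace ℝ (Fin (k + 1))) 1) :
      EuclideanSpace ℝ (Fin (k + 1)))})ᗮ ≃ₗᵢ[ℝ] EuclideanSpace ℝ (Fin k) :=
    (OrthonormalBasis.fromOrthogonalSpanSingleton k (ne_zero_of_mem_unit_sphere (-x))).repr
  have hu' : u ∈ (Submodule.span ℝ {((-x : sphere (0 : EuclideanSpace ℝ (Fin (k + 1))) 1) :
      EuclideanSpace ℝ (Fin (k + 1)))})ᗮ := by
    rw [Submodule.mem_orthogonal_singleton_iff_inner_left]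
    simpa using hx
  let ℓ : EuclideanSpace ℝ (Fin k) →ₗ[ℝ] ℝ :=
    (innerₛₗ ℝ u) ∘ₗ (Submodule.subtype _) ∘ₗ U.symm.toLinearEquiv.toLinearMap
  have hℓ : ∀ y, ℓ y = inner ℝ u (U.symm y : EuclideanSpace ℝ (Fin (k + 1))) := fun y => rfl
  have hℓ0 : ℓ ≠ 0 := by
    intro h
    have := hℓ (U ⟨u, hu'⟩)
    rw [h, U.symm_apply_apply, LinearMap.zero_apply] at this
    exact hu (inner_self_eq_zero.1 this.symm)
  refine ⟨LinearMap.ker ℓ, ?_, fun y hy => ?_⟩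
  · have := Module.Dual.finrank_ker_add_one_of_ne_zero hℓ0
    rw [finrank_euclideanSpace_fin] at this
    omega
  · have hy' : y ≠ -x := by
      have : y ∈ (stereographic' k (-x)).source := hy
      simpa using this
    have hyi : (1 : ℝ) - inner ℝ ((-x : sphere (0 : EuclideanSpace ℝ (Fin (k + 1))) 1) :
      EuclideanSpace ℝ (Fin (k + 1))) (y : EuclideanSpace ℝ (Fin (k + 1))) ≠ 0 := by
      rw [sub_ne_zero]
      exact fun h => hy' ((sphere_ext_iff _ _).2 h.symm).symm
    have he : chartAt (EuclideanSpace ℝ (Fin k)) x y =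
        U (stereoToFun _ (y : EuclideanSpace ℝ (Fin (k + 1)))) := rfl
    rw [he, LinearMap.mem_ker, hℓ, U.symm_apply_apply, stereoToFun_apply]
    simp only [Submodule.coe_smul, inner_smul_right, mul_eq_zero]
    have hp : inner ℝ u (((Submodule.span ℝ {((-x : sphere (0 : EuclideanSpace ℝ (Fin (k + 1))) 1) :
        EuclideanSpace ℝ (Fin (k + 1)))})ᗮ.orthogonalProjectionOnto
          (y : EuclideanSpace ℝ (Fin (k + 1))) : EuclideanSpace ℝ (Fin (k + 1)))) =
        inner ℝ u (y : EuclideanSpace ℝ (Fin (k + 1))) :=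
      Submodule.inner_orthogonalProjectionOnto_eq_of_mem_left (𝕜 := ℝ) ⟨u, hu'⟩
        (y : EuclideanSpace ℝ (Fin (k + 1)))
    rw [hp, innerSL_apply_apply, or_iff_right (div_ne_zero two_ne_zero hyi)]
    rfl


/-! ### The linear flow -/

/-- The exponent `0, 0, 1, 2, …` with which the linear flow contracts the `j`-th coordinate. -/
def rate {N : ℕ} (j : Fin N) : ℝ := ((j.val - 1 : ℕ) : ℝ)

/-- The linear flow on `ℝ^(n+3)` which rotates the plane of the first two coordinates with unit
speed and contracts the other coordinates with pairwise different exponents. -/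
noncomputable def linFlow {n : ℕ} (s : ℝ) (x : EuclideanSpace ℝ (Fin (n + 2 + 1))) :
    EuclideanSpace ℝ (Fin (n + 2 + 1)) :=
  WithLp.toLp 2 fun j =>
    if j = 0 then Real.cos s * x 0 - Real.sin s * x 1
    else if j = 1 then Real.sin s * x 0 + Real.cos s * x 1
    else Real.exp (-(rate j * s)) * x j

variable {n : ℕ} (s t : ℝ) (x y : EuclideanSpace ℝ (Fin (n + 2 + 1)))

@[simp] theorem linFlow_apply_zero :
    linFlow s x 0 = Real.cos s * x 0 - Real.sin s * x 1 := by simp [linFlow]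

@[simp] theorem linFlow_apply_one :
    linFlow s x 1 = Real.sin s * x 0 + Real.cos s * x 1 := by simp [linFlow]

theorem linFlow_apply {j : Fin (n + 2 + 1)} (h₀ : j ≠ 0) (h₁ : j ≠ 1) :
    linFlow s x j = Real.exp (-(rate j * s)) * x j := by simp [linFlow, h₀, h₁]

theorem euclidean_ext_three (h₀ : x 0 = y 0) (h₁ : x 1 = y 1) (h : ∀ j, j ≠ 0 → j ≠ 1 → x j = y j) :
    x = y := by
  ext j
  rcases eq_or_ne j 0 with rfl | hj₀
  · exact h₀
  rcases eq_or_ne j 1 with rfl | hj₁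
  · exact h₁
  · exact h j hj₀ hj₁

theorem linFlow_zero : linFlow 0 x = x := by
  refine euclidean_ext_three _ _ (by simp) (by simp) fun j h₀ h₁ => ?_
  simp [linFlow_apply _ _ h₀ h₁]

theorem linFlow_add : linFlow (s + t) x = linFlow s (linFlow t x) := by
  refine euclidean_ext_three _ _ ?_ ?_ fun j h₀ h₁ => ?_
  · simp only [linFlow_apply_zero, linFlow_apply_one, Real.sin_add, Real.cos_add]
    ring
  · simp only [linFlow_apply_zero, linFlow_apply_one, Real.sin_add, Real.cos_add]
    ring
  · rw [linFlow_apply _ _ h₀ h₁, linFlow_apply _ _ h₀ h₁, linFlow_apply _ _ h₀ h₁, ← mul_assoc,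
      ← Real.exp_add]
    ring_nf

theorem linFlow_smul (c : ℝ) : linFlow s (c • x) = c • linFlow s x := by
  refine euclidean_ext_three _ _ ?_ ?_ fun j h₀ h₁ => ?_
  · simp only [linFlow_apply_zero, PiLp.smul_apply, smul_eq_mul]
    ring
  · simp only [linFlow_apply_one, PiLp.smul_apply, smul_eq_mul]
    ring
  · simp only [linFlow_apply _ _ h₀ h₁, PiLp.smul_apply, smul_eq_mul]
    ring

variable {x} in
theorem linFlow_ne_zero (hx : x ≠ 0) : linFlow s x ≠ 0 := by
  intro h
  have h' := linFlow_add (-s) s x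
  rw [neg_add_cancel, linFlow_zero, h, ← zero_smul ℝ (0 : EuclideanSpace ℝ (Fin (n + 2 + 1))),
    linFlow_smul, zero_smul] at h'
  exact hx h'

theorem contDiff_linFlow :
    ContDiff ℝ ∞ fun y : ℝ × EuclideanSpace ℝ (Fin (n + 2 + 1)) => linFlow y.1 y.2 := by
  rw [contDiff_euclidean]
  intro j
  have hc : ∀ i, ContDiff ℝ ∞ fun y : ℝ × EuclideanSpace ℝ (Fin (n + 2 + 1)) => y.2 i := fun i =>
    (contDiff_piLp_apply (p := 2) (i := i)).comp contDiff_snd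
  rcases eq_or_ne j 0 with rfl | h₀
  · simp only [linFlow_apply_zero]
    exact (contDiff_fst.cos.mul (hc 0)).sub (contDiff_fst.sin.mul (hc 1))
  rcases eq_or_ne j 1 with rfl | h₁
  · simp only [linFlow_apply_one]
    exact (contDiff_fst.sin.mul (hc 0)).add (contDiff_fst.cos.mul (hc 1))
  · simp only [linFlow_apply _ _ h₀ h₁]
    exact (contDiff_const.mul contDiff_fst).neg.exp.mul (hc j)

/-- Sums of squares weighted by a function of the rate evolve under the linear flow as if it were
diagonal, because the two rotating coordinates have the same rate `0`. -/
theorem sum_rate_mul_linFlow_sq (w : ℝ → ℝ) :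
    ∑ j, w (rate j) * linFlow s x j ^ 2 =
      ∑ j, w (rate j) * (Real.exp (-(2 * rate j * s)) * x j ^ 2) := by
  rw [Fin.sum_univ_succ, Fin.sum_univ_succ, Fin.sum_univ_succ (n := n + 2),
    Fin.sum_univ_succ (n := n + 1)]
  have h₂ : ∀ i : Fin (n + 1), linFlow s x i.succ.succ ^ 2 =
      Real.exp (-(2 * rate (i.succ.succ) * s)) * x i.succ.succ ^ 2 := by
    intro i
    rw [linFlow_apply _ _ (Fin.succ_ne_zero _) (Fin.succ_succ_ne_one _), mul_pow, ← Real.exp_nat_mul]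
    push_cast
    ring_nf
  have e₁ : Fin.succ (0 : Fin (n + 2)) = 1 := rfl
  simp only [h₂, e₁, linFlow_apply_zero, linFlow_apply_one]
  have r₀ : rate (0 : Fin (n + 2 + 1)) = 0 := by simp [rate]
  have r₁ : rate (1 : Fin (n + 2 + 1)) = 0 := by simp [rate]
  simp only [r₀, r₁, mul_zero, zero_mul, neg_zero, Real.exp_zero, one_mul]
  linear_combination (w 0 * (x 0 ^ 2 + x 1 ^ 2)) * Real.sin_sq_add_cos_sq s

theorem norm_linFlow_sq :
    ‖linFlow s x‖ ^ 2 = ∑ j, Real.exp (-(2 * rate j * s)) * x j ^ 2 := by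
  rw [EuclideanSpace.real_norm_sq_eq]
  simpa using sum_rate_mul_linFlow_sq s x fun _ => 1

end Sphere

/-! ### The flow on the sphere -/

section SphereFlow

open Metric

/-- The unit sphere of dimension `n + 2`. -/
abbrev USphere (n : ℕ) : Type := sphere (0 : EuclideanSpace ℝ (Fin (n + 2 + 1))) 1

variable {n : ℕ}

theorem USphere.ne_zero (x : USphere n) : (x : EuclideanSpace ℝ (Fin (n + 2 + 1))) ≠ 0 :=
  ne_zero_of_mem_unit_sphere x

theorem USphere.norm_linFlow_pos (s : ℝ) (x : USphere n) : 0 < ‖linFlow s x.1‖ :=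
  norm_pos_iff.2 (linFlow_ne_zero s x.ne_zero)

theorem normalize_linFlow_mem (s : ℝ) (x : USphere n) :
    ‖linFlow s x.1‖⁻¹ • linFlow s x.1 ∈ sphere (0 : EuclideanSpace ℝ (Fin (n + 2 + 1))) 1 := by
  rw [mem_sphere_zero_iff_norm, norm_smul, norm_inv, norm_norm,
    inv_mul_cancel₀ (USphere.norm_linFlow_pos s x).ne']

/-- The flow on the sphere induced by the linear flow on rays. -/
noncomputable def sphereFlow (s : ℝ) (x : USphere n) : USphere n :=
  ⟨‖linFlow s x.1‖⁻¹ • linFlow s x.1, normalize_linFlow_mem s x⟩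

theorem sphereFlow_apply (s : ℝ) (x : USphere n) (j : Fin (n + 2 + 1)) :
    (sphereFlow s x).1 j = ‖linFlow s x.1‖⁻¹ * linFlow s x.1 j := rfl

theorem isSmoothFlow_sphereFlow : IsSmoothFlow (m := n + 2) (sphereFlow (n := n)) where
  zero x := by
    ext1
    simp [sphereFlow, linFlow_zero]
  add s t x := by
    ext1
    have h := USphere.norm_linFlow_pos t x
    have h' := USphere.norm_linFlow_pos (s + t) x
    simp only [sphereFlow, linFlow_smul, norm_smul, norm_inv, norm_norm, ← linFlow_add, smul_smul]
    congr 1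
    field_simp
  smooth := by
    have := Fact.mk (@finrank_euclideanSpace_fin ℝ _ (n + 2 + 1))
    have h : ContMDiff (𝓘(ℝ, ℝ).prod (𝓡 (n + 2))) 𝓘(ℝ, EuclideanSpace ℝ (Fin (n + 2 + 1))) ∞
        fun y : ℝ × USphere n => ‖linFlow y.1 y.2.1‖⁻¹ • linFlow y.1 y.2.1 := by
      have h₁ : ContMDiff (𝓘(ℝ, ℝ).prod (𝓡 (n + 2)))
          𝓘(ℝ, ℝ × EuclideanSpace ℝ (Fin (n + 2 + 1))) ∞
          fun y : ℝ × USphere n => (y.1, (y.2 : EuclideanSpace ℝ (Fin (n + 2 + 1)))) :=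
        contMDiff_fst.prodMk_space (contMDiff_coe_sphere.comp contMDiff_snd)
      have h₂ := contDiff_linFlow.contMDiff.comp h₁
      intro y
      have hy := USphere.norm_linFlow_pos y.1 y.2
      have h₃ : ContDiffAt ℝ ∞ (fun v : EuclideanSpace ℝ (Fin (n + 2 + 1)) => ‖v‖⁻¹ • v)
          (linFlow y.1 y.2.1) :=
        ((contDiffAt_norm ℝ (norm_pos_iff.1 hy)).inv hy.ne').smul contDiffAt_id
      exact ContMDiffAt.comp (g := fun v : EuclideanSpace ℝ (Fin (n + 2 + 1)) => ‖v‖⁻¹ • v)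
        (f := fun y : ℝ × USphere n => linFlow y.1 y.2.1) y h₃.contMDiffAt (h₂ y)
    exact h.codRestrict_sphere fun y => normalize_linFlow_mem y.1 y.2

theorem continuous_sphereFlow (x : USphere n) : Continuous fun s => sphereFlow s x :=
  (isSmoothFlow_sphereFlow.contMDiff_curve x).continuous

theorem continuous_coord (j : Fin (n + 2 + 1)) : Continuous fun x : USphere n => x.1 j :=
  (EuclideanSpace.proj (𝕜 := ℝ) j).continuous.comp continuous_subtype_val

theorem USphere.sum_sq (x : USphere n) : ∑ j, x.1 j ^ 2 = 1 := by
  rw [← EuclideanSpace.real_norm_sq_eq, norm_eq_of_mem_sphere, one_pow]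

theorem USphere.exists_ne_zero (x : USphere n) : ∃ j, x.1 j ≠ 0 := by
  by_contra! h
  simpa [h] using x.sum_sq

/-- Along a trajectory which meets two coordinate blocks of different rates, the squared norm of
the least contracted block is strictly increasing. -/
theorem exists_strictMono_sphereFlow {x : USphere n} {i j : Fin (n + 2 + 1)} (hi : x.1 i ≠ 0)
    (hj : x.1 j ≠ 0) (hij : rate i ≠ rate j) :
    ∃ h : USphere n → ℝ, Continuous h ∧ StrictMono fun s => h (sphereFlow s x) := by
  classical
  -- the least rate `μ` of a nonzero coordinate, and a nonzero coordinate `l` of larger rate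
  obtain ⟨i₀, hi₀, hmin⟩ := Finset.exists_min_image (Finset.univ.filter fun j => x.1 j ≠ 0) rate
    ⟨i, by simpa using hi⟩
  simp only [Finset.mem_filter, Finset.mem_univ, true_and] at hi₀ hmin
  obtain ⟨l, hl, hlμ⟩ : ∃ l, x.1 l ≠ 0 ∧ rate i₀ < rate l := by
    by_contra! h
    exact hij (((h i hi).antisymm (hmin i hi)).trans ((h j hj).antisymm (hmin j hj)).symm)
  set μ := rate i₀ with hμ
  -- the weight `w` selects the block of rate `μ`; on it the squared norm of the normalized orbit is
  -- `c / D`, where the factor `exp (-2 μ s)` has been cancelled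
  let w : ℝ → ℝ := fun r => if r = μ then 1 else 0
  refine ⟨fun y => ∑ j, w (rate j) * y.1 j ^ 2, continuous_finsetSum _ fun j _ =>
    continuous_const.mul ((continuous_coord j).pow 2), ?_⟩
  let c := ∑ j, w (rate j) * x.1 j ^ 2
  have hw : ∀ r, 0 ≤ w r := fun r => by simp only [w]; split_ifs <;> norm_num
  have hc : 0 < c := Finset.sum_pos' (fun j _ => mul_nonneg (hw _) (sq_nonneg _))
    ⟨i₀, Finset.mem_univ _, by simp only [w, ← hμ, if_true, one_mul]; positivity⟩
  let D : ℝ → ℝ := fun s => ∑ j, Real.exp (-(2 * (rate j - μ) * s)) * x.1 j ^ 2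
  have hDpos : ∀ s, 0 < D s := fun s => Finset.sum_pos' (fun j _ => by positivity)
    ⟨i₀, Finset.mem_univ _, by positivity⟩
  have hD : StrictAnti D := by
    intro s t hst
    refine Finset.sum_lt_sum (fun j _ => ?_) ⟨l, Finset.mem_univ _, ?_⟩
    · rcases eq_or_ne (x.1 j) 0 with h | h
      · simp [h]
      · have := mul_nonneg (sub_nonneg.2 (hmin j h)) (sub_nonneg.2 hst.le)
        exact mul_le_mul_of_nonneg_right (Real.exp_le_exp.2 (by linarith)) (sq_nonneg _)
    · have := mul_pos (sub_pos.2 hlμ) (sub_pos.2 hst)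
      exact mul_lt_mul_of_pos_right (Real.exp_lt_exp.2 (by linarith)) (by positivity)
  have key : ∀ s, ∑ j, w (rate j) * (sphereFlow s x).1 j ^ 2 = c / D s := by
    intro s
    have h₁ : ∑ j, w (rate j) * (sphereFlow s x).1 j ^ 2 =
        (‖linFlow s x.1‖ ^ 2)⁻¹ * ∑ j, w (rate j) * linFlow s x.1 j ^ 2 := by
      rw [Finset.mul_sum]
      refine Finset.sum_congr rfl fun j _ => ?_
      rw [sphereFlow_apply]
      ring
    have h₂ : ∑ j, w (rate j) * (Real.exp (-(2 * rate j * s)) * x.1 j ^ 2) =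
        Real.exp (-(2 * μ * s)) * c := by
      rw [Finset.mul_sum]
      refine Finset.sum_congr rfl fun j _ => ?_
      rcases eq_or_ne (rate j) μ with h | h
      · rw [h]
        ring
      · simp [w, h]
    have h₃ : ∑ j, Real.exp (-(2 * rate j * s)) * x.1 j ^ 2 = Real.exp (-(2 * μ * s)) * D s := by
      rw [Finset.mul_sum]
      refine Finset.sum_congr rfl fun j _ => ?_
      rw [← mul_assoc, ← Real.exp_add]
      ring_nf
    rw [h₁, sum_rate_mul_linFlow_sq, h₂, norm_linFlow_sq, h₃]
    have := hDpos s
    have := Real.exp_pos (-(2 * μ * s))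
    field_simp
  intro s t hst
  simp only [key]
  exact div_lt_div_of_pos_left hc (hDpos t) (hD hst)

end SphereFlow

/-! ### The vector field -/

section Field

open Metric

variable {n : ℕ}

/-- The point of the sphere on the first coordinate axis. -/
noncomputable def basePt (n : ℕ) : USphere n :=
  ⟨EuclideanSpace.single 0 1, by simp⟩

@[simp] theorem basePt_zero : (basePt n).1 0 = 1 := by simp [basePt]

theorem basePt_apply {j : Fin (n + 2 + 1)} (hj : j ≠ 0) : (basePt n).1 j = 0 := by
  simp [basePt, hj]

/-- The generator of the projected linear flow, slowed down so as to vanish at `basePt n`. -/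
noncomputable def slowedField (n : ℕ) : VectorField (n + 2) (USphere n) :=
  fun x => (1 - x.1 0) • generator (m := n + 2) sphereFlow x

theorem smoothFieldOn_generator_sphereFlow :
    SmoothFieldOn (generator (m := n + 2) (sphereFlow (n := n))) univ :=
  isSmoothFlow_sphereFlow.smoothFieldOn_generator

theorem smoothFieldOn_slowedField : SmoothFieldOn (slowedField n) univ := by
  have := Fact.mk (@finrank_euclideanSpace_fin ℝ _ (n + 2 + 1))
  have h : ContMDiff (𝓡 (n + 2)) 𝓘(ℝ, ℝ) ∞ fun x : USphere n => 1 - x.1 0 := by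
    have h₁ : ContDiff ℝ ∞ fun v : EuclideanSpace ℝ (Fin (n + 2 + 1)) => 1 - v 0 :=
      contDiff_const.sub (contDiff_piLp_apply (p := 2) (i := 0))
    exact h₁.contMDiff.comp contMDiff_coe_sphere
  exact (h.smul_section smoothFieldOn_generator_sphereFlow.contMDiff).contMDiffOn

/-- The great circle in the plane of the first two coordinates. -/
def loop (n : ℕ) : Set (USphere n) := {x | ∀ j, j ≠ 0 → j ≠ 1 → x.1 j = 0}

theorem basePt_mem_loop : basePt n ∈ loop n := fun _ h _ => basePt_apply h

theorem isClosed_loop : IsClosed (loop n) := by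
  simp only [loop, ofPred_forall]
  exact isClosed_iInter fun j => isClosed_iInter fun _ => isClosed_iInter fun _ =>
    isClosed_eq (continuous_coord j) continuous_const

theorem sum_eq_add_of_eq_zero (f : Fin (n + 2 + 1) → ℝ) (h : ∀ j, j ≠ 0 → j ≠ 1 → f j = 0) :
    ∑ j, f j = f 0 + f 1 := by
  rw [Fin.sum_univ_succ, Fin.sum_univ_succ,
    Finset.sum_eq_zero fun i _ => h _ (Fin.succ_ne_zero _) (Fin.succ_succ_ne_one _), add_zero]
  rfl

theorem sq_add_sq_le (x : USphere n) : x.1 0 ^ 2 + x.1 1 ^ 2 ≤ 1 := by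
  have h := x.sum_sq
  rw [Fin.sum_univ_succ, Fin.sum_univ_succ, ← add_assoc] at h
  exact (le_add_of_nonneg_right (Finset.sum_nonneg fun i _ => sq_nonneg _)).trans_eq h

theorem sq_add_sq_of_mem_loop {x : USphere n} (hx : x ∈ loop n) : x.1 0 ^ 2 + x.1 1 ^ 2 = 1 := by
  exact (sum_eq_add_of_eq_zero (fun j => x.1 j ^ 2) fun j h₀ h₁ => by simp [hx j h₀ h₁]).symm.trans x.sum_sq

theorem coord_zero_le (x : USphere n) : x.1 0 ≤ 1 := by
  nlinarith [sq_add_sq_le x, sq_nonneg (x.1 1)]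

theorem neg_one_le_coord_zero (x : USphere n) : -1 ≤ x.1 0 := by
  nlinarith [sq_add_sq_le x, sq_nonneg (x.1 1)]

theorem one_sub_pos {x : USphere n} (hx : x ≠ basePt n) : 0 < 1 - x.1 0 := by
  refine sub_pos.2 (lt_of_le_of_ne (coord_zero_le x) fun h => hx ?_)
  rw [sphere_ext_iff]
  simpa [basePt, EuclideanSpace.inner_single_right] using h

@[simp] theorem rate_zero : rate (0 : Fin (n + 2 + 1)) = 0 := by simp [rate]

@[simp] theorem rate_one : rate (1 : Fin (n + 2 + 1)) = 0 := by simp [rate]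

theorem norm_linFlow_of_mem_loop {x : USphere n} (hx : x ∈ loop n) (s : ℝ) :
    ‖linFlow s x.1‖ = 1 := by
  have h := norm_linFlow_sq s x.1
  rw [sum_eq_add_of_eq_zero _ fun j h₀ h₁ => by simp [hx j h₀ h₁]] at h
  simp only [rate_zero, rate_one, mul_zero, zero_mul, neg_zero, Real.exp_zero, one_mul,
    sq_add_sq_of_mem_loop hx] at h
  exact (pow_eq_one_iff_of_nonneg (norm_nonneg _) two_ne_zero).1 h

theorem sphereFlow_mem_loop_iff {x : USphere n} {s : ℝ} : sphereFlow s x ∈ loop n ↔ x ∈ loop n := by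
  refine forall_congr' fun j => forall_congr' fun h₀ => forall_congr' fun h₁ => ?_
  rw [sphereFlow_apply, linFlow_apply _ _ h₀ h₁]
  simp [(USphere.norm_linFlow_pos s x).ne', Real.exp_ne_zero]

theorem sphereFlow_basePt_zero (θ : ℝ) : (sphereFlow θ (basePt n)).1 0 = Real.cos θ := by
  simp [sphereFlow_apply, norm_linFlow_of_mem_loop basePt_mem_loop, basePt_apply]

theorem sphereFlow_basePt_one (θ : ℝ) : (sphereFlow θ (basePt n)).1 1 = Real.sin θ := by
  simp [sphereFlow_apply, norm_linFlow_of_mem_loop basePt_mem_loop, basePt_apply]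

theorem sphereFlow_basePt_mem_loop (θ : ℝ) : sphereFlow θ (basePt n) ∈ loop n :=
  sphereFlow_mem_loop_iff.2 basePt_mem_loop

theorem ext_of_mem_loop {x y : USphere n} (hx : x ∈ loop n) (hy : y ∈ loop n)
    (h₀ : x.1 0 = y.1 0) (h₁ : x.1 1 = y.1 1) : x = y :=
  Subtype.ext (euclidean_ext_three _ _ h₀ h₁ fun j hj₀ hj₁ => by rw [hx j hj₀ hj₁, hy j hj₀ hj₁])

theorem exists_polar (a b : ℝ) : ∃ φ ∈ Ioc (-Real.pi) Real.pi,
    a = √(a ^ 2 + b ^ 2) * Real.cos φ ∧ b = √(a ^ 2 + b ^ 2) * Real.sin φ := by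
  have h : ‖(⟨a, b⟩ : ℂ)‖ = √(a ^ 2 + b ^ 2) := by
    rw [Complex.norm_eq_sqrt_sq_add_sq]
  refine ⟨Complex.arg ⟨a, b⟩, Complex.arg_mem_Ioc _, ?_, ?_⟩
  · rw [← h, Complex.norm_mul_cos_arg]
  · rw [← h, Complex.norm_mul_sin_arg]

theorem exists_sphereFlow_basePt {x : USphere n} (hx : x ∈ loop n) :
    ∃ θ, sphereFlow θ (basePt n) = x := by
  obtain ⟨φ, -, h₀, h₁⟩ := exists_polar (x.1 0) (x.1 1)
  rw [sq_add_sq_of_mem_loop hx, Real.sqrt_one, one_mul] at h₀ h₁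
  exact ⟨φ, ext_of_mem_loop (sphereFlow_basePt_mem_loop _) hx
    (by rw [sphereFlow_basePt_zero, h₀]) (by rw [sphereFlow_basePt_one, h₁])⟩

/-! ### Integral curves -/

theorem exists_isMIntegralCurve_of_notMem_loop {x : USphere n} (hx : x ∉ loop n) :
    ∃ σ : ℝ ≃o ℝ, IsMIntegralCurve (fun t => sphereFlow (σ t) x) (slowedField n) := by
  obtain ⟨σ, hσ⟩ := exists_time_change (g := fun s => 1 - (sphereFlow s x).1 0) (C := 2)
    (continuous_const.sub ((continuous_coord 0).comp (continuous_sphereFlow x)))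
    (fun s => one_sub_pos fun h => hx (sphereFlow_mem_loop_iff.1 (h ▸ basePt_mem_loop)))
    (fun s => by linarith [neg_one_le_coord_zero (sphereFlow s x)])
  exact ⟨σ, isMIntegralCurve_comp (f := fun y : USphere n => 1 - y.1 0)
    (isSmoothFlow_sphereFlow.isMIntegralCurve x) hσ⟩

theorem mem_range_sphereFlow_comp (σ : ℝ ≃o ℝ) (x : USphere n) :
    x ∈ range fun t => sphereFlow (σ t) x :=
  ⟨σ.symm 0, by simp [isSmoothFlow_sphereFlow.zero]⟩

/-- A global integral curve of `slowedField n` which parametrizes the loop without its base point. -/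
noncomputable def loopCurve (n : ℕ) (t : ℝ) : USphere n :=
  sphereFlow (Real.pi + 2 * Real.arctan t) (basePt n)

theorem isMIntegralCurve_loopCurve : IsMIntegralCurve (loopCurve n) (slowedField n) := by
  refine isMIntegralCurve_comp (f := fun y : USphere n => 1 - y.1 0) (σ := fun t => Real.pi + 2 * Real.arctan t)
    (isSmoothFlow_sphereFlow.isMIntegralCurve (basePt n)) fun t => ?_
  have h := ((Real.hasDerivAt_arctan t).const_mul 2).const_add Real.pi
  have h' : 1 - (sphereFlow (Real.pi + 2 * Real.arctan t) (basePt n)).1 0 = 2 * (1 / (1 + t ^ 2)) := by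
    rw [sphereFlow_basePt_zero, ← Real.cos_sq_arctan, add_comm Real.pi, Real.cos_add_pi, Real.cos_two_mul]
    ring
  rw [← h'] at h
  exact h

theorem range_loopCurve : range (loopCurve n) = loop n \ {basePt n} := by
  ext x
  constructor
  · rintro ⟨t, rfl⟩
    refine ⟨sphereFlow_basePt_mem_loop _, fun h => ?_⟩
    have h' : (loopCurve n t).1 0 = 1 := by rw [mem_singleton_iff.1 h, basePt_zero]
    rw [loopCurve, sphereFlow_basePt_zero, add_comm Real.pi, Real.cos_add_pi, Real.cos_two_mul,
      Real.cos_sq_arctan] at h'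
    have : 0 < 1 / (1 + t ^ 2) := by positivity
    linarith
  · rintro ⟨hx, hxq⟩
    -- the angle is measured from the antipode of the base point, so that `φ / 2` is an arctangent
    obtain ⟨φ, hφ, h₀, h₁⟩ := exists_polar (-x.1 0) (-x.1 1)
    rw [neg_sq, neg_sq, sq_add_sq_of_mem_loop hx, Real.sqrt_one, one_mul] at h₀ h₁
    have hφπ : φ ≠ Real.pi := by
      rintro rfl
      refine hxq (ext_of_mem_loop hx basePt_mem_loop ?_ ?_)
      · rw [Real.cos_pi] at h₀
        rw [basePt_zero]
        linarith
      · rw [Real.sin_pi] at h₁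
        rw [basePt_apply one_ne_zero]
        linarith
    have hlt := lt_of_le_of_ne hφ.2 hφπ
    have hθ : Real.pi + 2 * Real.arctan (Real.tan (φ / 2)) = φ + Real.pi := by
      rw [Real.arctan_tan (by linarith [hφ.1]) (by linarith)]
      ring
    refine ⟨Real.tan (φ / 2), ext_of_mem_loop (sphereFlow_basePt_mem_loop _) hx ?_ ?_⟩
    · rw [loopCurve, sphereFlow_basePt_zero, hθ, Real.cos_add_pi, ← h₀, neg_neg]
    · rw [loopCurve, sphereFlow_basePt_one, hθ, Real.sin_add_pi, ← h₁, neg_neg]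

theorem sphereFlow_two_pi_basePt : sphereFlow (2 * Real.pi) (basePt n) = basePt n :=
  ext_of_mem_loop (sphereFlow_basePt_mem_loop _) basePt_mem_loop
    (by rw [sphereFlow_basePt_zero, Real.cos_two_pi, basePt_zero])
    (by rw [sphereFlow_basePt_one, Real.sin_two_pi, basePt_apply one_ne_zero])

theorem tendsto_loopCurve_atTop : Tendsto (loopCurve n) atTop (𝓝 (basePt n)) := by
  have h : Tendsto (fun t => Real.pi + 2 * Real.arctan t) atTop (𝓝 (2 * Real.pi)) := by
    have := ((tendsto_nhds_of_tendsto_nhdsWithin Real.tendsto_arctan_atTop).const_mul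
      2).const_add Real.pi
    convert! this using 2
    ring
  have h' := ((continuous_sphereFlow (basePt n)).tendsto (2 * Real.pi)).comp h
  rwa [sphereFlow_two_pi_basePt] at h'

theorem tendsto_loopCurve_atBot : Tendsto (loopCurve n) atBot (𝓝 (basePt n)) := by
  have h : Tendsto (fun t => Real.pi + 2 * Real.arctan t) atBot (𝓝 0) := by
    have := ((tendsto_nhds_of_tendsto_nhdsWithin Real.tendsto_arctan_atBot).const_mul
      2).const_add Real.pi
    convert! this using 2
    ring
  have h' := ((continuous_sphereFlow (basePt n)).tendsto 0).comp h
  rwa [isSmoothFlow_sphereFlow.zero] at h'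

end Field

/-! ### Limit sets -/

section Limits

open Metric

variable {n : ℕ}

theorem mapClusterPt_eq_of_tendsto_comp {X Y α : Type*} [TopologicalSpace X] [TopologicalSpace Y]
    [T2Space Y] {γ : α → X} {l : Filter α} {x : X} {h : X → Y} {c : Y} (hx : MapClusterPt x l γ)
    (hh : Continuous h) (hc : Tendsto (fun t => h (γ t)) l (𝓝 c)) : h x = c :=
  have h' : ClusterPt (h x) (map (h ∘ γ) l) := hx.continuousAt_comp hh.continuousAt
  eq_of_nhds_neBot (h'.mono hc)

theorem mapClusterPt_iff_eq_of_tendsto {X α : Type*} [TopologicalSpace X] [T2Space X] {γ : α → X}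
    {l : Filter α} [l.NeBot] {x c : X} (hc : Tendsto γ l (𝓝 c)) : MapClusterPt x l γ ↔ x = c :=
  ⟨fun h => mapClusterPt_eq_of_tendsto_comp h continuous_id hc, fun h => h ▸ hc.mapClusterPt⟩

variable {p : USphere n}

theorem trajectory_of_mem_loop (hp : p ∈ loop n) (hpq : p ≠ basePt n) :
    trajectory (slowedField n) p = loop n \ {basePt n} := by
  rw [trajectory_eq_range smoothFieldOn_slowedField isMIntegralCurve_loopCurve
    (range_loopCurve.symm ▸ ⟨hp, hpq⟩), range_loopCurve]

theorem omegaLim_of_mem_loop (hp : p ∈ loop n) (hpq : p ≠ basePt n) :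
    omegaLim (slowedField n) p = {basePt n} := by
  ext x
  rw [mem_omegaLim_iff smoothFieldOn_slowedField isMIntegralCurve_loopCurve
    (range_loopCurve.symm ▸ ⟨hp, hpq⟩), mapClusterPt_iff_eq_of_tendsto tendsto_loopCurve_atTop,
    mem_singleton_iff]

theorem alphaLim_of_mem_loop (hp : p ∈ loop n) (hpq : p ≠ basePt n) :
    alphaLim (slowedField n) p = {basePt n} := by
  ext x
  rw [mem_alphaLim_iff smoothFieldOn_slowedField isMIntegralCurve_loopCurve
    (range_loopCurve.symm ▸ ⟨hp, hpq⟩), mapClusterPt_iff_eq_of_tendsto tendsto_loopCurve_atBot,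
    mem_singleton_iff]

theorem one_le_rate {j : Fin (n + 2 + 1)} (h₀ : j ≠ 0) (h₁ : j ≠ 1) : 1 ≤ rate j := by
  have h₀' : j.val ≠ 0 := fun h => h₀ (Fin.ext h)
  have h₁' : j.val ≠ 1 := fun h => h₁ (Fin.ext (by rw [h]; rfl))
  simp only [rate, Nat.one_le_cast]
  omega

theorem tendsto_linFlow_apply (x : EuclideanSpace ℝ (Fin (n + 2 + 1))) {j : Fin (n + 2 + 1)}
    (h₀ : j ≠ 0) (h₁ : j ≠ 1) : Tendsto (fun s => linFlow s x j) atTop (𝓝 0) := by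
  simp only [linFlow_apply _ _ h₀ h₁]
  rw [← zero_mul (x j)]
  refine Tendsto.mul_const _ (Real.tendsto_exp_neg_atTop_nhds_zero.comp ?_)
  exact tendsto_id.const_mul_atTop (zero_lt_one.trans_le (one_le_rate h₀ h₁))

theorem sqrt_le_norm_linFlow (x : USphere n) (s : ℝ) :
    √(x.1 0 ^ 2 + x.1 1 ^ 2) ≤ ‖linFlow s x.1‖ := by
  refine (Real.sqrt_le_left (norm_nonneg _)).2 ?_
  rw [norm_linFlow_sq, Fin.sum_univ_succ, Fin.sum_univ_succ, ← add_assoc]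
  have e : Fin.succ (0 : Fin (n + 2)) = 1 := rfl
  simp only [e, rate_zero, rate_one, mul_zero, zero_mul, neg_zero, Real.exp_zero, one_mul]
  exact le_add_of_nonneg_right (Finset.sum_nonneg fun i _ => by positivity)

/-- Points off the loop with a nonzero component in the plane of the loop spiral towards the whole
loop. -/
theorem omegaLim_of_notMem_loop (hp : p ∉ loop n) (hz : 0 < p.1 0 ^ 2 + p.1 1 ^ 2) :
    omegaLim (slowedField n) p = loop n := by
  obtain ⟨σ, hσ⟩ := exists_isMIntegralCurve_of_notMem_loop hp
  set r := √(p.1 0 ^ 2 + p.1 1 ^ 2) with hr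
  have hr0 : 0 < r := Real.sqrt_pos.2 hz
  ext y
  rw [mem_omegaLim_iff smoothFieldOn_slowedField hσ (mem_range_sphereFlow_comp σ p)]
  constructor
  · intro hy j h₀ h₁
    refine mapClusterPt_eq_of_tendsto_comp (h := fun x : USphere n => x.1 j) hy
      (continuous_coord j) ?_
    refine Tendsto.comp (g := fun s => (sphereFlow s p).1 j) ?_ σ.tendsto_atTop
    have h := (tendsto_linFlow_apply p.1 h₀ h₁).abs.const_mul r⁻¹
    rw [abs_zero, mul_zero] at h
    refine squeeze_zero_norm (fun s => ?_) h
    rw [sphereFlow_apply, norm_mul, norm_inv, norm_norm, Real.norm_eq_abs]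
    exact mul_le_mul_of_nonneg_right (inv_anti₀ hr0 (sqrt_le_norm_linFlow p s)) (abs_nonneg _)
  · intro hy
    obtain ⟨θ, rfl⟩ := exists_sphereFlow_basePt hy
    obtain ⟨α, -, h₀, h₁⟩ := exists_polar (p.1 0) (p.1 1)
    rw [← hr] at h₀ h₁
    -- the times at which the component in the plane of the loop has the direction `θ`
    let S : ℕ → ℝ := fun N => θ - α + N * (2 * Real.pi)
    have hS : Tendsto S atTop atTop := tendsto_atTop_add_const_left _ _
      (tendsto_natCast_atTop_atTop.atTop_mul_const Real.two_pi_pos)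
    have hc : ∀ N, linFlow (S N) p.1 0 = r * Real.cos θ := fun N => by
      rw [linFlow_apply_zero, h₀, h₁, Real.cos_add_nat_mul_two_pi, Real.sin_add_nat_mul_two_pi]
      have : θ = θ - α + α := by ring
      conv_rhs => rw [this, Real.cos_add]
      ring
    have hs : ∀ N, linFlow (S N) p.1 1 = r * Real.sin θ := fun N => by
      rw [linFlow_apply_one, h₀, h₁, Real.cos_add_nat_mul_two_pi, Real.sin_add_nat_mul_two_pi]
      have : θ = θ - α + α := by ring
      conv_rhs => rw [this, Real.sin_add]
      ring
    let v : EuclideanSpace ℝ (Fin (n + 2 + 1)) := r • (sphereFlow θ (basePt n)).1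
    have hv : ‖v‖ = r := by
      rw [norm_smul, norm_eq_of_mem_sphere, mul_one, Real.norm_of_nonneg hr0.le]
    have hlim : Tendsto (fun N => linFlow (S N) p.1) atTop (𝓝 v) := by
      have h : Tendsto (fun N => (linFlow (S N) p.1).ofLp) atTop (𝓝 v.ofLp) := by
        refine tendsto_pi_nhds.2 fun j => ?_
        rcases eq_or_ne j 0 with rfl | hj₀
        · simp [hc, v, sphereFlow_basePt_zero]
        rcases eq_or_ne j 1 with rfl | hj₁
        · simp [hs, v, sphereFlow_basePt_one]
        · have e : v.ofLp j = 0 := by simp [v, hy j hj₀ hj₁]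
          rw [e]
          exact (tendsto_linFlow_apply p.1 hj₀ hj₁).comp hS
      exact ((PiLp.continuous_toLp 2 _).tendsto _).comp h
    have hlim' : Tendsto (fun N => sphereFlow (S N) p) atTop (𝓝 (sphereFlow θ (basePt n))) := by
      rw [tendsto_subtype_rng]
      have h := (hlim.norm.inv₀ (by rw [hv]; exact hr0.ne')).smul hlim
      rw [hv, smul_smul, inv_mul_cancel₀ hr0.ne', one_smul] at h
      exact h
    refine MapClusterPt.of_comp (φ := fun N => σ.symm (S N)) (p := atTop)
      (σ.symm.tendsto_atTop.comp hS) ?_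
    simpa [Function.comp_def] using hlim'.mapClusterPt

/-! ### Zeros -/

theorem rate_inj {i j : Fin (n + 2 + 1)} (h₀ : j ≠ 0) (h₁ : j ≠ 1) (h : rate i = rate j) :
    i = j := by
  have h₀' : j.val ≠ 0 := fun h => h₀ (Fin.ext h)
  have h₁' : j.val ≠ 1 := fun h => h₁ (Fin.ext (by rw [h]; rfl))
  simp only [rate, Nat.cast_inj] at h
  exact Fin.ext (by omega)

theorem sphereFlow_eq_of_generator_eq_zero (h : generator (m := n + 2) sphereFlow p = 0) (s : ℝ) :
    sphereFlow s p = p := by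
  have : IsManifold (𝓡 (n + 2)) 1 (USphere n) := IsManifold.of_le (n := ∞) (by norm_cast)
  have h' := isMIntegralCurve_Ioo_eq_of_contMDiff_boundaryless (t₀ := 0)
    (smoothFieldOn_generator_sphereFlow.contMDiff.of_le (by norm_cast))
    (isSmoothFlow_sphereFlow.isMIntegralCurve p) (isMIntegralCurve_const h)
    (isSmoothFlow_sphereFlow.zero p)
  exact congrFun h' s

theorem generator_eq_zero (h : ∀ s, sphereFlow s p = p) :
    generator (m := n + 2) sphereFlow p = 0 := by
  have key : ∀ f : ℝ → USphere n, f = (fun _ => p) →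
      (mfderiv 𝓘(ℝ, ℝ) (𝓡 (n + 2)) f 0 (1 : ℝ) : EuclideanSpace ℝ (Fin (n + 2))) = 0 := by
    rintro _ rfl
    rw [mfderiv_const]
    rfl
  exact key _ (funext h)

/-- The zeros of the projected linear flow lie on the contracted coordinate axes. -/
theorem exists_axis_of_generator_eq_zero (h : generator (m := n + 2) sphereFlow p = 0) :
    ∃ j, j ≠ 0 ∧ j ≠ 1 ∧ ∀ i, i ≠ j → p.1 i = 0 := by
  have hfix := sphereFlow_eq_of_generator_eq_zero h
  have hpos := USphere.norm_linFlow_pos Real.pi p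
  -- at time `π` the component in the rotating plane has been multiplied by a negative number
  have hz : p.1 0 = 0 ∧ p.1 1 = 0 := by
    have h₀ := sphereFlow_apply Real.pi p 0
    have h₁ := sphereFlow_apply Real.pi p 1
    rw [hfix, linFlow_apply_zero, Real.cos_pi, Real.sin_pi] at h₀
    rw [hfix, linFlow_apply_one, Real.cos_pi, Real.sin_pi] at h₁
    have hinv := inv_pos.2 hpos
    constructor
    · have : (1 + ‖linFlow Real.pi p.1‖⁻¹) * p.1 0 = 0 := by linear_combination h₀
      exact (mul_eq_zero.1 this).resolve_left (by positivity)
    · have : (1 + ‖linFlow Real.pi p.1‖⁻¹) * p.1 1 = 0 := by linear_combination h₁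
      exact (mul_eq_zero.1 this).resolve_left (by positivity)
  obtain ⟨j, hj⟩ := p.exists_ne_zero
  have hj₀ : j ≠ 0 := by rintro rfl; exact hj hz.1
  have hj₁ : j ≠ 1 := by rintro rfl; exact hj hz.2
  refine ⟨j, hj₀, hj₁, fun i hij => ?_⟩
  by_contra hi
  obtain ⟨f, -, hf⟩ := exists_strictMono_sphereFlow hi hj fun hr => hij (rate_inj hj₀ hj₁ hr)
  have := hf (zero_lt_one (α := ℝ))
  simp only [hfix, lt_irrefl] at this

theorem generator_eq_zero_of_axis {j : Fin (n + 2 + 1)} (h₀ : j ≠ 0) (h₁ : j ≠ 1)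
    (h : ∀ i, i ≠ j → p.1 i = 0) : generator (m := n + 2) sphereFlow p = 0 := by
  refine generator_eq_zero fun s => Subtype.ext ?_
  have hL : linFlow s p.1 = Real.exp (-(rate j * s)) • p.1 := by
    refine euclidean_ext_three _ _ ?_ ?_ fun i hi₀ hi₁ => ?_
    · simp [h 0 h₀.symm, h 1 h₁.symm]
    · simp [h 0 h₀.symm, h 1 h₁.symm]
    · rw [linFlow_apply _ _ hi₀ hi₁]
      rcases eq_or_ne i j with rfl | hij
      · rfl
      · simp [h i hij]
  change ‖linFlow s p.1‖⁻¹ • linFlow s p.1 = p.1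
  rw [hL, norm_smul, norm_eq_of_mem_sphere, mul_one, Real.norm_of_nonneg (Real.exp_pos _).le,
    smul_smul, inv_mul_cancel₀ (Real.exp_pos _).ne', one_smul]

theorem slowedField_eq_zero_iff :
    slowedField n p = 0 ↔ p = basePt n ∨ ∃ j, j ≠ 0 ∧ j ≠ 1 ∧ ∀ i, i ≠ j → p.1 i = 0 := by
  constructor
  · intro h
    refine or_iff_not_imp_left.2 fun hp => exists_axis_of_generator_eq_zero ?_
    exact (smul_eq_zero.1 h).resolve_left (one_sub_pos hp).ne'
  · rintro (rfl | ⟨j, h₀, h₁, h⟩)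
    · simp [slowedField]
    · rw [slowedField, generator_eq_zero_of_axis h₀ h₁ h, smul_zero]

/-- A regular point off the loop has nonzero coordinates of two different rates. -/
theorem exists_rate_ne (hp : slowedField n p ≠ 0) (hpl : p ∉ loop n) :
    ∃ i j, j ≠ 0 ∧ j ≠ 1 ∧ p.1 i ≠ 0 ∧ p.1 j ≠ 0 ∧ rate i ≠ rate j := by
  obtain ⟨j, h₀, h₁, hj⟩ : ∃ j, j ≠ 0 ∧ j ≠ 1 ∧ p.1 j ≠ 0 := by
    simpa [loop] using hpl
  obtain ⟨i, hij, hi⟩ : ∃ i, i ≠ j ∧ p.1 i ≠ 0 := by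
    by_contra! h
    exact hp (slowedField_eq_zero_iff.2 (Or.inr ⟨j, h₀, h₁, h⟩))
  exact ⟨i, j, h₀, h₁, hi, hj, fun hr => hij (rate_inj h₀ h₁ hr)⟩

theorem finite_zeros : {x | slowedField n x = 0}.Finite := by
  have hinj : Function.Injective fun x : USphere n => x.1.ofLp :=
    (WithLp.ofLp_injective 2).comp Subtype.val_injective
  -- all coordinates of a zero are `-1`, `0` or `1`
  refine ((Set.Finite.pi' fun _ : Fin (n + 2 + 1) =>
    ((finite_singleton (1 : ℝ)).insert 0).insert (-1)).preimage hinj.injOn).subset fun x hx i => ?_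
  simp only [mem_insert_iff, mem_singleton_iff]
  rcases slowedField_eq_zero_iff.1 hx with rfl | ⟨j, -, -, h⟩
  · rcases eq_or_ne i 0 with rfl | hi
    · simp
    · simp [basePt_apply hi]
  · rcases eq_or_ne i j with rfl | hij
    · have hs := x.sum_sq
      rw [Finset.sum_eq_single i (fun l _ hl => by simp [h l hl]) (by simp)] at hs
      rcases sq_eq_sq_iff_eq_or_eq_neg.1 (hs.trans (one_pow 2).symm) with h | h <;> simp [h]
    · simp [h i hij]

theorem not_accPt_zeros (x : USphere n) : ¬ AccPt x (𝓟 {y | slowedField n y = 0}) :=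
  fun h => Set.Infinite.of_accPt h finite_zeros

theorem isIsolatedSingularity_basePt : IsIsolatedSingularity (slowedField n) (basePt n) := by
  refine ⟨slowedField_eq_zero_iff.2 (Or.inl rfl), ?_⟩
  have := not_accPt_zeros (basePt n)
  rwa [accPt_iff_frequently_nhdsNE, not_frequently] at this

end Limits

/-! ### The pseudo-circle -/

section PseudoCircle

open Metric

variable {n : ℕ}

theorem slowedField_ne_zero_of_mem_loop {p : USphere n} (hp : p ∈ loop n) (hpq : p ≠ basePt n) :
    slowedField n p ≠ 0 := by
  intro h
  rcases slowedField_eq_zero_iff.1 h with h | ⟨j, h₀, h₁, h⟩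
  · exact hpq h
  · have := sq_add_sq_of_mem_loop hp
    rw [h 0 h₀.symm, h 1 h₁.symm] at this
    norm_num at this

theorem loopCurve_mem (t : ℝ) : loopCurve n t ∈ loop n \ {basePt n} :=
  range_loopCurve ▸ mem_range_self t

theorem nonempty_loop_homeomorph_circle : Nonempty (loop n ≃ₜ Circle) := by
  let f : loop n → Circle := fun x => ⟨⟨x.1.1 0, x.1.1 1⟩, mem_sphere_zero_iff_norm.2 <| by
    rw [Complex.norm_eq_sqrt_sq_add_sq, sq_add_sq_of_mem_loop x.2,
      Real.sqrt_one]⟩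
  have hre : ∀ x, (f x : ℂ).re = x.1.1 0 := fun _ => rfl
  have him : ∀ x, (f x : ℂ).im = x.1.1 1 := fun _ => rfl
  have hinj : Function.Injective f := fun x y hxy => Subtype.ext <|
    ext_of_mem_loop x.2 y.2 (by rw [← hre, hxy, hre]) (by rw [← him, hxy, him])
  have hsurj : Function.Surjective f := fun z => by
    refine ⟨⟨sphereFlow (Complex.arg z) (basePt n), sphereFlow_basePt_mem_loop _⟩,
      Circle.ext (Complex.ext ?_ ?_)⟩
    · rw [hre, sphereFlow_basePt_zero, ← Complex.norm_mul_cos_arg (z : ℂ), Circle.norm_coe, one_mul]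
    · rw [him, sphereFlow_basePt_one, ← Complex.norm_mul_sin_arg (z : ℂ), Circle.norm_coe, one_mul]
  have hcont : Continuous f := by
    have h₀ : Continuous fun x : loop n => x.1.1 0 := (continuous_coord 0).comp continuous_subtype_val
    have h₁ : Continuous fun x : loop n => x.1.1 1 := (continuous_coord 1).comp continuous_subtype_val
    exact (Complex.equivRealProdCLM.symm.continuous.comp (h₀.prodMk h₁)).subtype_mk _
  have : CompactSpace (loop n) := isCompact_iff_compactSpace.1 isClosed_loop.isCompact
  exact ⟨Continuous.homeoOfEquivCompactToT2 (f := Equiv.ofBijective f ⟨hinj, hsurj⟩) hcont⟩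

theorem isPseudoCircle_loop : IsPseudoCircle (slowedField n) (loop n) := by
  have h := loopCurve_mem (n := n) 0
  refine ⟨nonempty_loop_homeomorph_circle, loopCurve n 0, basePt n,
    slowedField_ne_zero_of_mem_loop h.1 h.2, isIsolatedSingularity_basePt, ?_⟩
  rw [trajectory_of_mem_loop h.1 h.2, sdiff_union_self, union_eq_self_of_subset_right
    (singleton_subset_iff.2 basePt_mem_loop)]

/-- A curve along which a continuous function is strictly monotone is not compactified by one
point: the maximum and the minimum of the function would both be attained at that point. -/
theorem not_isCompact_range_union {X : Type*} [TopologicalSpace X] {γ : ℝ → X} {h : X → ℝ}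
    (hh : Continuous h) (hγ : StrictMono fun t => h (γ t)) (q : X) :
    ¬ IsCompact (range γ ∪ {q}) := by
  intro hK
  have hne : (range γ ∪ {q}).Nonempty := ⟨q, Or.inr rfl⟩
  obtain ⟨a, ha, hmax⟩ := hK.exists_isMaxOn hne hh.continuousOn
  obtain ⟨b, hb, hmin⟩ := hK.exists_isMinOn hne hh.continuousOn
  have hmem : ∀ t, γ t ∈ range γ ∪ {q} := fun t => Or.inl ⟨t, rfl⟩
  have haq : a = q := by
    rcases ha with ⟨t, rfl⟩ | ha
    · exact absurd (hmax (hmem (t + 1))) (not_le.2 (hγ (lt_add_one t)))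
    · exact ha
  have hbq : b = q := by
    rcases hb with ⟨t, rfl⟩ | hb
    · exact absurd (hmin (hmem (t - 1))) (not_le.2 (hγ (sub_one_lt t)))
    · exact hb
  subst haq hbq
  have h₁ : h (γ 1) ≤ h b := hmax (hmem 1)
  have h₂ : h b ≤ h (γ 0) := hmin (hmem 0)
  exact absurd (hγ zero_lt_one) (not_lt.2 (h₁.trans h₂))

theorem IsPseudoCircle.eq_loop {P : Set (USphere n)} (hP : IsPseudoCircle (slowedField n) P) :
    P = loop n := by
  obtain ⟨⟨e⟩, p, q, hp, -, rfl⟩ := hP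
  have hK : IsCompact (trajectory (slowedField n) p ∪ {q}) :=
    isCompact_iff_compactSpace.2 e.symm.compactSpace
  by_cases hpl : p ∈ loop n
  · have hpq : p ≠ basePt n := by
      rintro rfl
      exact hp (slowedField_eq_zero_iff.2 (Or.inl rfl))
    rw [trajectory_of_mem_loop hpl hpq] at hK ⊢
    -- a compact set containing the loop without its base point contains the base point
    have hb : basePt n ∈ loop n \ {basePt n} ∪ {q} :=
      hK.isClosed.mem_of_tendsto tendsto_loopCurve_atTop
        (Eventually.of_forall fun t => Or.inl (loopCurve_mem t))
    obtain rfl : basePt n = q := hb.resolve_left fun h => h.2 rfl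
    rw [sdiff_union_self, union_eq_self_of_subset_right (singleton_subset_iff.2 basePt_mem_loop)]
  · obtain ⟨i, j, -, -, hi, hj, hij⟩ := exists_rate_ne hp hpl
    obtain ⟨h, hh, hmono⟩ := exists_strictMono_sphereFlow hi hj hij
    obtain ⟨σ, hσ⟩ := exists_isMIntegralCurve_of_notMem_loop hpl
    rw [trajectory_eq_range smoothFieldOn_slowedField hσ (mem_range_sphereFlow_comp σ p)] at hK
    exact absurd hK (not_isCompact_range_union hh (hmono.comp σ.strictMono) q)

theorem not_isPeriodicRegular (p : USphere n) : ¬ IsPeriodicRegular (slowedField n) p := by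
  rintro ⟨hp, γ, hγ, hpγ, T, hT, hper⟩
  have hmax := isMaximalIntegralCurve_univ hγ
  have hpγ' : p ∈ γ '' univ := by rwa [image_univ]
  by_cases hpl : p ∈ loop n
  · have hpq : p ≠ basePt n := by
      rintro rfl
      exact hp (slowedField_eq_zero_iff.2 (Or.inl rfl))
    obtain ⟨-, c, rfl⟩ := hmax.eq_translate smoothFieldOn_slowedField isMIntegralCurve_loopCurve
      (range_loopCurve.symm ▸ ⟨hpl, hpq⟩) hpγ'
    -- a periodic curve with a limit is constant
    have h₁ : Tendsto (fun N : ℕ => loopCurve n (N * T + c)) atTop (𝓝 (basePt n)) :=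
      tendsto_loopCurve_atTop.comp (tendsto_atTop_add_const_right _ _
        (tendsto_natCast_atTop_atTop.atTop_mul_const hT))
    have h₂ : ∀ N : ℕ, loopCurve n (N * T + c) = loopCurve n (0 + c) := fun N => hper.nat_mul_eq N
    simp only [h₂] at h₁
    exact (loopCurve_mem _).2 (tendsto_nhds_unique tendsto_const_nhds h₁)
  · obtain ⟨i, j, -, -, hi, hj, hij⟩ := exists_rate_ne hp hpl
    obtain ⟨h, hh, hmono⟩ := exists_strictMono_sphereFlow hi hj hij
    obtain ⟨σ, hσ⟩ := exists_isMIntegralCurve_of_notMem_loop hpl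
    obtain ⟨-, c, rfl⟩ := hmax.eq_translate smoothFieldOn_slowedField hσ
      (mem_range_sphereFlow_comp σ p) hpγ'
    have h₁ := hmono (σ.strictMono (show 0 + c < T + c by linarith))
    have h₂ : sphereFlow (σ (T + c)) p = sphereFlow (σ (0 + c)) p := by
      simpa using hper 0
    simp only [h₂, lt_irrefl] at h₁

/-- Outside two great hyperspheres, every trajectory has the loop as `ω`-limit. -/
theorem exists_enclosed_compl : ∃ Q : Set (USphere n), EnclosedInDim (n + 2) (n + 2 - 1) Q ∧
    ∀ p ∉ Q, IsPseudoCircle (slowedField n) (omegaLim (slowedField n) p) := by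
  let N : Fin (n + 2 + 1) → Set (USphere n) := fun j => {x | x.1 j = 0}
  have hN : ∀ j, IsSubmanifold (n + 2) (n + 2 - 1) (N j) := fun j => by
    have h := isSubmanifold_great_hypersphere (k := n + 2)
      (u := EuclideanSpace.single j (1 : ℝ)) (by simp)
    simpa [EuclideanSpace.inner_single_left] using h
  let l : Fin (n + 2 + 1) := ⟨2, by omega⟩
  have hl₀ : l ≠ 0 := fun h => by simpa [l] using congrArg Fin.val h
  have hl₁ : l ≠ 1 := fun h => by simpa [l] using congrArg Fin.val h
  refine ⟨N 0 ∪ N l, ⟨{N 0, N l}, (finite_singleton _).insert _ |>.countable, ?_, ?_⟩,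
    fun p hp => ?_⟩
  · rintro _ (rfl | rfl)
    · exact ⟨_, le_rfl, hN 0⟩
    · exact ⟨_, le_rfl, hN l⟩
  · rw [sUnion_pair]
  · have h₀ : p.1 0 ≠ 0 := fun h => hp (Or.inl h)
    have hl : p.1 l ≠ 0 := fun h => hp (Or.inr h)
    rw [omegaLim_of_notMem_loop (fun h => hl (h l hl₀ hl₁)) (by positivity)]
    exact isPseudoCircle_loop

end PseudoCircle

/-! ### Rivets and chains -/

section Rivet

open Metric

variable {n : ℕ}

/-- A tangent vector of the sphere, as a vector of the ambient Euclidean space. -/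
noncomputable def ambient (x : USphere n) :
    TangentSpace (𝓡 (n + 2)) x →L[ℝ] EuclideanSpace ℝ (Fin (n + 2 + 1)) :=
  mvfderiv (𝓡 (n + 2)) (Subtype.val : USphere n → EuclideanSpace ℝ (Fin (n + 2 + 1))) x

theorem contMDiff_val : ContMDiff (𝓡 (n + 2)) 𝓘(ℝ, EuclideanSpace ℝ (Fin (n + 2 + 1))) ∞
    (Subtype.val : USphere n → EuclideanSpace ℝ (Fin (n + 2 + 1))) :=
  have := Fact.mk (@finrank_euclideanSpace_fin ℝ _ (n + 2 + 1))
  contMDiff_coe_sphere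

theorem inner_ambient (x : USphere n) (v : TangentSpace (𝓡 (n + 2)) x) :
    inner ℝ x.1 (ambient x v) = 0 := by
  have := Fact.mk (@finrank_euclideanSpace_fin ℝ _ (n + 2 + 1))
  have h : ambient x v ∈ (ambient x).range := ⟨v, rfl⟩
  have h' := range_mvfderiv_subtypeVal (n := n + 2) x
  rw [ambient, h', Submodule.mem_orthogonal_singleton_iff_inner_right] at h
  exact h

theorem eq_zero_of_ambient_eq_zero {x : USphere n} {v : TangentSpace (𝓡 (n + 2)) x}
    (h : ambient x v = 0) : v = 0 := by
  have := Fact.mk (@finrank_euclideanSpace_fin ℝ _ (n + 2 + 1))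
  exact injective_mvfderiv_subtypeVal_sphere (n := n + 2) x (h.trans (map_zero (ambient x)).symm)

theorem continuousOn_ambient {W : VectorField (n + 2) (USphere n)} {U : Set (USphere n)}
    (hW : SmoothFieldOn W U) : ContinuousOn (fun x => ambient x (W x)) U := by
  have h₁ := (contMDiff_val (n := n)).continuous_tangentMap (by simp)
  have h₂ := h₁.comp_continuousOn hW.continuousOn
  exact (continuous_snd.comp (tangentBundleModelSpaceHomeomorph
    𝓘(ℝ, EuclideanSpace ℝ (Fin (n + 2 + 1)))).continuous).comp_continuousOn h₂

/-- If a coordinate vanishes along the trajectory of a regular point `x`, it vanishes on every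
tangent vector proportional to the field at `x`. -/
theorem ambient_apply_eq_zero {x : USphere n} {v : TangentSpace (𝓡 (n + 2)) x} {c : ℝ}
    (hx : slowedField n x ≠ 0) (hv : slowedField n x = c • v) {i : Fin (n + 2 + 1)}
    (hi : ∀ s, (sphereFlow s x).1 i = 0) : ambient x v i = 0 := by
  have h₁ : HasDerivAt (fun s => (sphereFlow s x).1)
      (ambient x (generator (m := n + 2) sphereFlow x)) 0 := by
    have h := HasMFDerivAt.comp (f := fun s => sphereFlow s x) (0 : ℝ)
      ((contMDiff_val (n := n)).mdifferentiable (by simp) (sphereFlow 0 x)).hasMFDerivAt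
      (isSmoothFlow_sphereFlow.isMIntegralCurve x 0)
    let A : ℝ →L[ℝ] EuclideanSpace ℝ (Fin (n + 2 + 1)) := (ambient (sphereFlow 0 x)).comp
      ((1 : ℝ →L[ℝ] ℝ).smulRight (generator (m := n + 2) sphereFlow (sphereFlow 0 x)))
    have h' : HasDerivAt (fun s => (sphereFlow s x).1) (A 1) 0 :=
      HasFDerivAt.hasDerivAt (f' := A) (hasMFDerivAt_iff_hasFDerivAt.1 h)
    have key : ∀ y, y = x → ambient y (generator (m := n + 2) sphereFlow y) =
        ambient x (generator (m := n + 2) sphereFlow x) := by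
      rintro _ rfl
      rfl
    rw [← key _ (isSmoothFlow_sphereFlow.zero x)]
    convert! h' using 1
    exact congrArg (ambient (sphereFlow 0 x)) (one_smul ℝ _).symm
  have h₂ : ambient x (generator (m := n + 2) sphereFlow x) i = 0 := by
    have h := ((EuclideanSpace.proj (𝕜 := ℝ) i).hasFDerivAt.comp_hasDerivAt 0 h₁)
    have h' : HasDerivAt (fun _ : ℝ => (0 : ℝ)) (ambient x (generator (m := n + 2) sphereFlow x) i) 0 := by
      convert! h using 1
      ext s
      exact (hi s).symm
    exact h'.unique (hasDerivAt_const _ _)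
  have h₃ : c * ambient x v i = 0 := by
    have := congrArg (fun w => ambient x w i) hv
    simp only [slowedField, map_smul, PiLp.smul_apply, smul_eq_mul, h₂, mul_zero] at this
    exact this.symm
  refine (mul_eq_zero.1 h₃).resolve_left ?_
  rintro rfl
  exact hx (by rw [hv, zero_smul])

theorem sphereFlow_apply_eq_zero {x : USphere n} {i : Fin (n + 2 + 1)}
    (h : ∀ i', rate i' = rate i → x.1 i' = 0) (s : ℝ) : (sphereFlow s x).1 i = 0 := by
  rw [sphereFlow_apply]
  rcases eq_or_ne i 0 with rfl | h₀
  · simp [h 0 rfl, h 1 (by simp)]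
  rcases eq_or_ne i 1 with rfl | h₁
  · simp [h 1 rfl, h 0 (by simp)]
  · rw [linFlow_apply _ _ h₀ h₁, h i rfl, mul_zero, mul_zero]

/-- The great circle through `r` in the direction of the `l`-th coordinate axis, which is orthogonal
to `r` when `r l = 0`. -/
noncomputable def greatCircle (r : USphere n) {l : Fin (n + 2 + 1)} (hl : r.1 l = 0) (s : ℝ) :
    USphere n :=
  ⟨Real.cos s • r.1 + Real.sin s • EuclideanSpace.single l 1, by
    have h := norm_add_sq_real (Real.cos s • r.1)
      (Real.sin s • EuclideanSpace.single l (1 : ℝ))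
    rw [inner_smul_left, inner_smul_right, EuclideanSpace.inner_single_right, hl, norm_smul,
      norm_smul, norm_eq_of_mem_sphere, PiLp.norm_single, norm_one, mul_one, mul_one,
      Real.norm_eq_abs, Real.norm_eq_abs, sq_abs, sq_abs] at h
    simp only [map_zero, mul_zero, add_zero, Real.cos_sq_add_sin_sq] at h
    exact mem_sphere_zero_iff_norm.2 ((pow_eq_one_iff_of_nonneg (norm_nonneg _) two_ne_zero).1 h)⟩

theorem greatCircle_apply_self {r : USphere n} {l : Fin (n + 2 + 1)} (hl : r.1 l = 0) (s : ℝ) :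
    (greatCircle r hl s).1 l = Real.sin s := by
  simp [greatCircle, hl]

theorem greatCircle_apply {r : USphere n} {l i : Fin (n + 2 + 1)} (hl : r.1 l = 0) (hi : i ≠ l)
    (s : ℝ) : (greatCircle r hl s).1 i = Real.cos s * r.1 i := by
  simp [greatCircle, hi]

theorem continuous_greatCircle {r : USphere n} {l : Fin (n + 2 + 1)} (hl : r.1 l = 0) :
    Continuous (greatCircle r hl) :=
  ((Real.continuous_cos.smul continuous_const).add
    (Real.continuous_sin.smul continuous_const)).subtype_mk _

theorem greatCircle_zero {r : USphere n} {l : Fin (n + 2 + 1)} (hl : r.1 l = 0) :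
    greatCircle r hl 0 = r := by
  ext1
  simp [greatCircle]

/-- Near a zero `r` on a contracted axis, a factorization `ψ • W` of the field forces `W r = 0` as
soon as there is a second contracted axis. Indeed `W` is proportional to the field at the regular
points of the great circles through `r` towards the axes `l` and `0`; there the field has only
components in the coordinate subspaces of `j, l` and of `j, 0, 1` respectively, and by continuity
`W r` lies in both. Being tangent to the sphere, it also has no component along `r`. -/
theorem factor_eq_zero {r : USphere n} {j l : Fin (n + 2 + 1)} (hj₀ : j ≠ 0) (hj₁ : j ≠ 1)
    (hl₀ : l ≠ 0) (hl₁ : l ≠ 1) (hlj : l ≠ j) (hr : ∀ i, i ≠ j → r.1 i = 0)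
    {U : Set (USphere n)} (hU : IsOpen U) (hrU : r ∈ U) {ψ : USphere n → ℝ}
    {W : VectorField (n + 2) (USphere n)} (hW : SmoothFieldOn W U)
    (hψ : ∀ x ∈ U, slowedField n x = ψ x • W x) : W r = 0 := by
  have hrj : r.1 j ≠ 0 := by
    obtain ⟨i, hi⟩ := r.exists_ne_zero
    rcases eq_or_ne i j with rfl | hij
    · exact hi
    · exact absurd (hr i hij) hi
  have key : ∀ (l' i : Fin (n + 2 + 1)) (hl' : l' ≠ j),
      (∀ i', rate i' = rate i → i' ≠ j ∧ i' ≠ l') → ambient r (W r) i = 0 := by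
    intro l' i hl' hi
    have hl := hr l' hl'
    have hlim : Tendsto (greatCircle r hl) (𝓝[≠] 0) (𝓝 r) := by
      have h := (continuous_greatCircle hl).tendsto 0
      rw [greatCircle_zero] at h
      exact h.mono_left nhdsWithin_le_nhds
    have hcont : Tendsto (fun x => ambient x (W x) i) (𝓝 r) (𝓝 (ambient r (W r) i)) :=
      ((EuclideanSpace.proj (𝕜 := ℝ) i).continuous.tendsto _).comp
        ((continuousOn_ambient hW).continuousAt (hU.mem_nhds hrU))
    refine tendsto_nhds_unique (hcont.comp hlim) (tendsto_const_nhds.congr' ?_)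
    have hcos : ∀ᶠ s in 𝓝[≠] (0 : ℝ), Real.cos s ≠ 0 := nhdsWithin_le_nhds
      (Real.continuous_cos.continuousAt.eventually_ne (by simp))
    have hsin : ∀ᶠ s in 𝓝[≠] (0 : ℝ), Real.sin s ≠ 0 := by
      filter_upwards [self_mem_nhdsWithin,
        nhdsWithin_le_nhds (Ioo_mem_nhds (neg_lt_zero.2 Real.pi_pos) Real.pi_pos)] with s hs hs'
      exact fun h => hs ((Real.sin_eq_zero_iff_of_lt_of_lt hs'.1 hs'.2).1 h)
    filter_upwards [hcos, hsin, hlim (hU.mem_nhds hrU)] with s hc hs hsU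
    have hyj : (greatCircle r hl s).1 j ≠ 0 := by
      rw [greatCircle_apply hl hl'.symm]
      exact mul_ne_zero hc hrj
    have hyl : (greatCircle r hl s).1 l' ≠ 0 := by rwa [greatCircle_apply_self]
    refine (ambient_apply_eq_zero ?_ (hψ _ hsU) (sphereFlow_apply_eq_zero fun i' hi' => ?_)).symm
    · intro h
      rcases slowedField_eq_zero_iff.1 h with h | ⟨j', -, -, h⟩
      · exact hyj (by rw [h, basePt_apply hj₀])
      · have e₁ : j = j' := by_contra fun e => hyj (h j e)
        have e₂ : l' = j' := by_contra fun e => hyl (h l' e)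
        exact hl' (e₂.trans e₁.symm)
    · rw [greatCircle_apply hl (hi i' hi').2, hr i' (hi i' hi').1, mul_zero]
  have hi : ∀ i, i ≠ j → ambient r (W r) i = 0 := by
    intro i hij
    rcases eq_or_ne i l with rfl | hil
    · refine key 0 i hj₀.symm fun i' hi' => ?_
      obtain rfl := rate_inj hl₀ hl₁ hi'
      exact ⟨hij, hl₀⟩
    · refine key l i hlj fun i' hi' => ⟨?_, ?_⟩
      · rintro rfl
        exact hij (rate_inj hj₀ hj₁ hi'.symm)
      · rintro rfl
        exact hil (rate_inj hl₀ hl₁ hi'.symm)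
  refine eq_zero_of_ambient_eq_zero ?_
  ext i
  rcases eq_or_ne i j with rfl | hij
  · have h := inner_ambient r (W r)
    rw [PiLp.inner_apply, Finset.sum_eq_single i (fun l _ hl => by simp [hr l hl]) (by simp)] at h
    simpa [hrj] using h
  · exact hi i hij

/-- No regular trajectory has a single rivet as `ω`-limit. -/
theorem not_isRivet_of_omegaLim {p r : USphere n} (hp : slowedField n p ≠ 0)
    (h : omegaLim (slowedField n) p = {r}) : ¬ IsRivet (slowedField n) r := by
  rintro ⟨⟨hr0, -⟩, ⟨U, hU, hrU, ψ, W, -, hW, hWr, hψ⟩, hhom⟩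
  by_cases hpl : p ∈ loop n
  · have hpq : p ≠ basePt n := by
      rintro rfl
      exact hp (slowedField_eq_zero_iff.2 (Or.inl rfl))
    refine hhom ⟨p, hp, ?_, h⟩
    rw [← h, omegaLim_of_mem_loop hpl hpq, alphaLim_of_mem_loop hpl hpq]
  obtain ⟨i, j, hj₀, hj₁, hi, hj, hij⟩ := exists_rate_ne hp hpl
  by_cases hz : 0 < p.1 0 ^ 2 + p.1 1 ^ 2
  · rw [omegaLim_of_notMem_loop hpl hz] at h
    have h₁ : basePt n = r := h.subset basePt_mem_loop
    have h₂ : loopCurve n 0 = r := h.subset (loopCurve_mem 0).1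
    exact (loopCurve_mem (n := n) 0).2 (h₂.trans h₁.symm)
  have hp₀ : p.1 0 = 0 := by nlinarith [sq_nonneg (p.1 0), sq_nonneg (p.1 1)]
  have hp₁ : p.1 1 = 0 := by nlinarith [sq_nonneg (p.1 0), sq_nonneg (p.1 1)]
  have hi₀ : i ≠ 0 := by rintro rfl; exact hi hp₀
  have hi₁ : i ≠ 1 := by rintro rfl; exact hi hp₁
  -- the limit `r` lies on a contracted axis, since the plane of the loop is not approached
  obtain ⟨σ, hσ⟩ := exists_isMIntegralCurve_of_notMem_loop hpl
  have hr : MapClusterPt r atTop fun t => sphereFlow (σ t) p :=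
    (mem_omegaLim_iff smoothFieldOn_slowedField hσ (mem_range_sphereFlow_comp σ p)).1
      (h.symm ▸ mem_singleton r)
  have hr₀ : r.1 0 = 0 := by
    refine mapClusterPt_eq_of_tendsto_comp (h := fun x : USphere n => x.1 0) hr
      (continuous_coord 0) (tendsto_const_nhds.congr fun t => ?_)
    simp [sphereFlow_apply, hp₀, hp₁]
  rcases slowedField_eq_zero_iff.1 hr0 with rfl | ⟨a, ha₀, ha₁, ha⟩
  · simp at hr₀
  have hne : i ≠ j := fun e => hij (e ▸ rfl)
  rcases eq_or_ne i a with rfl | hia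
  · exact hWr (factor_eq_zero ha₀ ha₁ hj₀ hj₁ hne.symm ha hU hrU hW hψ)
  · exact hWr (factor_eq_zero ha₀ ha₁ hi₀ hi₁ hia ha hU hrU hW hψ)

theorem isLimit_slowedField : IsLimit (slowedField n) where
  smooth := smoothFieldOn_slowedField
  zeros_discrete := not_accPt_zeros
  unique_pseudoCircle := ⟨loop n, isPseudoCircle_loop, fun _ h => h.eq_loop⟩
  exists_enclosed := exists_enclosed_compl
  no_chain := by
    rintro ⟨N, c, hc⟩
    obtain ⟨-, r, hr, hω⟩ := hc.consecutive 0
    exact not_isRivet_of_omegaLim (hc.regular _) hω hr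
  no_periodic := fun ⟨p, hp⟩ => not_isPeriodicRegular p hp

end Rivet

end LimitField

theorem proposition2p1 (k : ℕ) (hk : 2 ≤ k) :
    ∃ Z : LimitField.VectorField k (Metric.sphere (0 : EuclideanSpace ℝ (Fin (k + 1))) 1),
      LimitField.IsLimit Z := by
  obtain ⟨n, rfl⟩ := Nat.exists_eq_add_of_le' hk
  exact ⟨LimitField.slowedField n, LimitField.isLimit_slowedField⟩
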